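/- Let $d\ge 1$, and let $X=\{X_n\}_{n\ge 0}$ be a transient time-homogeneous Markov chain on $\mathbf Z^d$, with law $P^a$ when started at $a$, and Green function $g(a,x)=\sum_{n\ge0}P^a\{X_n=x\}$. Let $\mathcal V_k=[-2^k,2^k)^d$ for $k\ge0$, $\mathcal S_0=\mathcal V_0$ and $\mathcal S_{k+1}=\mathcal V_{k+1}\setminus\mathcal V_k$. For $n\in\mathbf Z$ let $\mathcal D_n$ be the collection of the dyadic cubes $\prod_{i=1}^d[j_i2^n,(j_i+1)2^n)$, $j\in\mathbf Z^d$. For every $k\ge 0$ let $U_k(Q)$, with $Q\subseteq\mathcal V_k$ a dyadic cube, be random variables uniformly distributed on $[0,1]$, all of them (for all $k$ and $Q$) independent. For $q\in(0,1]$, macroscopic fractal percolation is the random set $\Pi_q=\bigcup_{k\ge0}(\Pi_{q,k}\cap\mathcal S_k)$, where $\Pi_{q,k}$ is the union of all unit cubes $Q\in\mathcal D_0$ with $Q\subseteq\mathcal V_k$ such that $U_k(Q')\in(0,q)$ for every $Q'\in\bigcup_{j=0}^{k}\mathcal D_j$ with $Q\subseteq Q'\subseteq\mathcal V_k$. For $x,y\in\mathbf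 Z^d$ write $x\leftrightarrow y$ if $x$ and $y$ lie in the same shell $\mathcal S_k$; in that case let $\mathrm d(x,y)=(k+1)-\min\{n\ge0:\ x,y\in Q\text{ for some }Q\in\mathcal D_n\}$, and $\mathrm d(x,y)=0$ if no dyadic cube contains both $x$ and $y$. For $p\in(0,1]$, $a\in\mathbf Z^d$ and a probability measure $\mu$ on $\mathbf Z^d$ let $$I(\mu;a)=\sum_{x\not\leftrightarrow y}\frac{g(x,y)}{g(a,y)}\mu(x)\mu(y),\qquad I_p(\mu;a)=\sum_{x\leftrightarrow y}\frac{g(x,y)}{g(a,y)}\,p^{-\mathrm d(x,y)}\mu(x)\mu(y),$$ with quotients in $[0,\infty]$, where $c/0=\infty$ for $c>0$, $0/0=0$ and $\infty\cdot0=0$. The Martin $p$-capacity of $F\subseteq\mathbf Z^d$ is $$c_p(F;a)=\sup_{F_0\subseteq F,\ F_0\text{ finite}}\Big[\inf_{\mu}\big\{I(\mu;a)+I_p(\mu;a)\big\}\Big]^{-1},$$ where the infimum is over all probability measures $\mu$ on $F_0$, $1/\infty=0$, $1/0=\infty$, and $\inf\varnothing=\infty$. Then for every $a\in\mathbf Z^d$,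 every nonrandom finite set $F\subset\mathbf Z^d$, and all $p,q\in[2^{-d},1]$, $$256^{-1}\,c_{pq}(F;a)\ \le\ \mathrm E\big[c_p(\Pi_q\cap F;a)\big]\ \le\ 256\,c_{pq}(F;a).$$ -/

import Mathlib

open MeasureTheory ProbabilityTheory
open scoped ENNReal

namespace MacroPercolation

noncomputable section

/-! ## Markov chains on the lattice -/

/-- `X` is a (time-homogeneous) Markov chain on `ℤ^d`, defined on a measurable space `A` that
carries the laws `P a` (the law under which the chain starts at `a`).  The one-step transition
probability from `x` to `y` is `P x {X₁ = y}`. -/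
structure IsMarkovChain {d : ℕ} {A : Type*} [MeasurableSpace A]
    (P : (Fin d → ℤ) → Measure A) (X : ℕ → A → (Fin d → ℤ)) : Prop where
  isProb : ∀ a, IsProbabilityMeasure (P a)
  measurable : ∀ n, Measurable (X n)
  start : ∀ a, P a {w | X 0 w = a} = 1
  markov : ∀ (a : Fin d → ℤ) (n : ℕ) (z : ℕ → (Fin d → ℤ)),
    P a {w | ∀ i ≤ n + 1, X i w = z i} =
      P a {w | ∀ i ≤ n, X i w = z i} * P (z n) {w | X 1 w = z (n + 1)}

/-- Transience: from every state `x`, the probability of ever returning to `x` is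
less than one. -/
def IsTransient {d : ℕ} {A : Type*} [MeasurableSpace A]
    (P : (Fin d → ℤ) → Measure A) (X : ℕ → A → (Fin d → ℤ)) : Prop :=
  ∀ x : Fin d → ℤ, P x {w | ∃ n, 1 ≤ n ∧ X n w = x} < 1

/-- The Green function `g(a, x) = ∑ₙ P^a {Xₙ = x}`. -/
def green {d : ℕ} {A : Type*} [MeasurableSpace A]
    (P : (Fin d → ℤ) → Measure A) (X : ℕ → A → (Fin d → ℤ)) (a x : Fin d → ℤ) : ℝ≥0∞ :=
  ∑' n : ℕ, P a {w | X n w = x}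

/-! ## Dyadic cubes and shells -/

/-- The inclusion of `ℤ^d` in `ℝ^d`. -/
def toPoint {d : ℕ} (x : Fin d → ℤ) : Fin d → ℝ := fun i => (x i : ℝ)

/-- A dyadic cube of `ℝ^d`, recorded by its level `n` (the sidelength is `2 ^ n`) and the integer
vector `j` for which `2 ^ n • j` is its lower corner. -/
@[ext]
structure DyadicCube (d : ℕ) where
  level : ℤ
  corner : Fin d → ℤ

/-- The half-open cube `[j₁ 2ⁿ, (j₁ + 1) 2ⁿ) × ⋯ × [j_d 2ⁿ, (j_d + 1) 2ⁿ)`. -/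
def DyadicCube.toSet {d : ℕ} (Q : DyadicCube d) : Set (Fin d → ℝ) :=
  {x | ∀ i, (Q.corner i : ℝ) * (2 : ℝ) ^ Q.level ≤ x i ∧
    x i < ((Q.corner i : ℝ) + 1) * (2 : ℝ) ^ Q.level}

/-- `V_k = [-2^k, 2^k)^d`. -/
def bigCube (d k : ℕ) : Set (Fin d → ℝ) := {x | ∀ i, -(2 : ℝ) ^ k ≤ x i ∧ x i < (2 : ℝ) ^ k}

/-- The shells `S_0 = V_0` and `S_{k+1} = V_{k+1} \ V_k`. -/
def shell (d : ℕ) : ℕ → Set (Fin d → ℝ)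
  | 0 => bigCube d 0
  | k + 1 => bigCube d (k + 1) \ bigCube d k

/-- The dyadic cubes that are contained in `V_k`. -/
abbrev CubeIn (d k : ℕ) : Type := {Q : DyadicCube d // Q.toSet ⊆ bigCube d k}

/-! ## Macroscopic fractal percolation -/

/-- The weights of the percolation: for every `k` a family, indexed by the dyadic cubes in `V_k`,
of random variables with the uniform distribution on `[0, 1]`, all of them (also for different
`k`) independent. -/
structure IsUniformWeights {d : ℕ} {Ω : Type*} [MeasurableSpace Ω] (Pr : Measure Ω)
    (U : (k : ℕ) → CubeIn d k → Ω → ℝ) : Prop where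
  measurable : ∀ k Q, Measurable (U k Q)
  uniform : ∀ k Q, Pr.map (U k Q) = volume.restrict (Set.Icc (0 : ℝ) 1)
  indep : iIndepFun (fun i : (Σ k : ℕ, CubeIn d k) => U i.1 i.2) Pr

/-- The indicator `I_p(Q)` of the event that the weight of `Q` lies in `(0, p)`. -/
def keep {d k : ℕ} (p : ℝ) (u : CubeIn d k → ℝ) (Q : CubeIn d k) : ℕ :=
  (Set.Ioo 0 p).indicator 1 (u Q)

/-- Step `n` of fractal percolation in `V_k` for the weights `u`: the cubes of level `k - n`
in `V_k` all of whose ancestors in `V_k` (themselves included) are kept.  (No cube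
of level `k + 1` is contained in `V_k`, so the ancestors have levels `k - n, …, k`.) -/
def percolationStep {d : ℕ} (p : ℝ) (k n : ℕ) (u : CubeIn d k → ℝ) : Set (DyadicCube d) :=
  {Q | Q.level = (k : ℤ) - n ∧ Q.toSet ⊆ bigCube d k ∧
    ∀ Q' : CubeIn d k, Q.toSet ⊆ Q'.1.toSet → (k : ℤ) - n ≤ Q'.1.level →
      Q'.1.level ≤ (k : ℤ) + 1 → keep p u Q' = 1}

/-- Macroscopic fractal percolation `Π_p ⊆ ℝ^d` for the weights `u`: in the shell `S_k` it
is the union of the unit cubes that survive the step `k` of fractal percolation in `V_k`. -/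
def percolation {d : ℕ} (p : ℝ) (u : (k : ℕ) → CubeIn d k → ℝ) : Set (Fin d → ℝ) :=
  ⋃ k : ℕ, (⋃ Q ∈ percolationStep p k k (u k), Q.toSet) ∩ shell d k

/-! ## Energy and capacity -/

/-- `x ↔ y`: the points `x` and `y` lie in the same shell. -/
def SameShell {d : ℕ} (x y : Fin d → ℤ) : Prop :=
  ∃ k : ℕ, toPoint x ∈ shell d k ∧ toPoint y ∈ shell d k

/-- The index of the shell that contains `x`. -/
def shellIndex {d : ℕ} (x : Fin d → ℤ) : ℕ := sInf {k : ℕ | toPoint x ∈ shell d k}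

/-- The quantity `d(x, y)` for `x` and `y` in the same shell `S_k`:  `k + 1` minus the level of the
smallest common ancestor of `x` and `y`.  If no dyadic cube contains both points, their smallest
common ancestor is the root `V_k`, which counts as level `k + 1`. -/
def commonDepth {d : ℕ} (x y : Fin d → ℤ) : ℕ :=
  (shellIndex x + 1) -
    sInf {n : ℕ | n = shellIndex x + 1 ∨
      ∃ Q : DyadicCube d, Q.level = n ∧ toPoint x ∈ Q.toSet ∧ toPoint y ∈ Q.toSet}

open Classical in
/-- The energy `I(μ; a)`, for the Green function `g`: the sum over pairs in different shells.
Quotients are in `[0, ∞]`, with `0 / 0 = 0`, `c / 0 = ∞` for `c > 0`, and `∞ * 0 = 0`. -/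
def energyOff {d : ℕ} (g : (Fin d → ℤ) → (Fin d → ℤ) → ℝ≥0∞) (a : Fin d → ℤ)
    (μ : Measure (Fin d → ℤ)) : ℝ≥0∞ :=
  ∑' x : Fin d → ℤ, ∑' y : Fin d → ℤ,
    if SameShell x y then 0 else g x y / g a y * μ {x} * μ {y}

open Classical in
/-- The energy `I_p(μ; a)`, for the Green function `g`: the sum over pairs in the same shell. -/
def energyOn {d : ℕ} (g : (Fin d → ℤ) → (Fin d → ℤ) → ℝ≥0∞) (p : ℝ) (a : Fin d → ℤ)
    (μ : Measure (Fin d → ℤ)) : ℝ≥0∞ :=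
  ∑' x : Fin d → ℤ, ∑' y : Fin d → ℤ,
    if SameShell x y then
      g x y / g a y * (ENNReal.ofReal p)⁻¹ ^ commonDepth x y * μ {x} * μ {y}
    else 0

/-- The probability measures on `F`. -/
def probOn {d : ℕ} (F : Set (Fin d → ℤ)) : Set (Measure (Fin d → ℤ)) :=
  {μ | IsProbabilityMeasure μ ∧ μ Fᶜ = 0}

/-- The Martin `p`-capacity `c_p(F; a)`, with values in `[0, ∞]`; here `1 / ∞ = 0` and the infimum
over the empty set is `∞`, so that the empty set has capacity zero. -/
def capacity {d : ℕ} (g : (Fin d → ℤ) → (Fin d → ℤ) → ℝ≥0∞) (p : ℝ) (F : Set (Fin d → ℤ))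
    (a : Fin d → ℤ) : ℝ≥0∞ :=
  ⨆ F₀ : Set (Fin d → ℤ), ⨆ _ : F₀ ⊆ F ∧ F₀.Finite,
    (⨅ μ ∈ probOn F₀, energyOff g a μ + energyOn g p a μ)⁻¹

end

end MacroPercolation

/-! Both capacities are compared with a hitting probability. Let M be the probability that the chain
started at `a` visits the points of a finite set that survive an independent percolation with
parameter θ. The key estimate is c_θ/2 ≤ M ≤ 32 c_θ.

The left inequality is the second moment method (`inv_two_mul_treeEnergy_le`). Weight the occupation
time of each surviving point y by μ(y) / (g(a,y) P{y survives}). The total Z has mean 1 and second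
moment at most twice the energy of μ, because P{x and y survive} / (P{x survives} P{y survives}) is
θ to the power minus the number of common ancestors.

For the right inequality the test measure is the law ν of the first surviving point visited, of mass
M; its energy is at most 32 M (`treeEnergy_hitDist_le`). The first hit depends on the whole
percolation, so the strong Markov property alone does not suffice. The points are therefore explored
in a planar order of the tree of cubes, and the event of hitting at x is replaced by its conditional
probability given the ancestors of the points up to x. For y after x, only the common ancestors of x
and y are then already explored (`pair_energy_le`). Summation gives E[SZ], where S is the sum of
these conditional probabilities. The dual Doob inequality gives E[S²] ≤ 4M
(`lintegral_sum_condOn_sq_le`), while E[Z²] is at most twice the energy itself, which is absorbed.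

Finally, the intersection of independent percolations with parameters p and q is one with parameter
pq. Apply the estimate to pq on F, and to p on the surviving set of the q-percolation; the constant
is 2 · 32 = 64 ≤ 256. -/

namespace MacroPercolation

set_option linter.unusedSectionVars false

/-! ### The Markov property for events of the past -/

section Chain

variable {d : ℕ} {A : Type*} [MeasurableSpace A]
  {P : (Fin d → ℤ) → Measure A} {X : ℕ → A → (Fin d → ℤ)}

namespace IsMarkovChain

lemma measurableSet_eq (hX : IsMarkovChain P X) (n : ℕ) (x : Fin d → ℤ) :
    MeasurableSet {w | X n w = x} :=
  hX.measurable n (measurableSet_singleton x)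

lemma measurableSet_cylinder (hX : IsMarkovChain P X) (n : ℕ) (z : ℕ → Fin d → ℤ) :
    MeasurableSet {w | ∀ i ≤ n, X i w = z i} := by
  have : {w | ∀ i ≤ n, X i w = z i} = ⋂ i, ⋂ (_ : i ≤ n), {w | X i w = z i} := by
    ext; simp
  rw [this]
  exact .iInter fun i => .iInter fun _ => hX.measurableSet_eq i _

/-- Split according to the position u at time n + 1 and absorb u into the prescribed path. The
right-hand sum depends on the past only through `z n`, so the case n = 0 later identifies it as an
(m + 1)-step probability. -/
lemma cylinder_step (hX : IsMarkovChain P X) {m : ℕ} {y : Fin d → ℤ}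
    (ih : ∀ (a : Fin d → ℤ) (n : ℕ) (z : ℕ → Fin d → ℤ),
      P a ({w | ∀ i ≤ n, X i w = z i} ∩ {w | X (n + m) w = y}) =
        P a {w | ∀ i ≤ n, X i w = z i} * P (z n) {w | X m w = y})
    (a : Fin d → ℤ) (n : ℕ) (z : ℕ → Fin d → ℤ) :
    P a ({w | ∀ i ≤ n, X i w = z i} ∩ {w | X (n + (m + 1)) w = y}) =
      P a {w | ∀ i ≤ n, X i w = z i} *
        ∑' u, P (z n) {w | X 1 w = u} * P u {w | X m w = y} := by
  have hcyl : ∀ u, {w | ∀ i ≤ n + 1, X i w = Function.update z (n + 1) u i} =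
      {w | ∀ i ≤ n, X i w = z i} ∩ {w | X (n + 1) w = u} := by
    intro u
    ext w
    simp only [Set.mem_ofPred_eq, Set.mem_inter_iff]
    constructor
    · intro h
      refine ⟨fun i hi => ?_, ?_⟩
      · have := h i (by omega)
        rwa [Function.update_of_ne (by omega)] at this
      · simpa using h (n + 1) le_rfl
    · rintro ⟨h1, h2⟩ i hi
      rcases Nat.lt_or_ge n i with h | h
      · obtain rfl : i = n + 1 := by omega
        simpa using h2
      · rw [Function.update_of_ne (by omega)]
        exact h1 i h
  have hun : {w | ∀ i ≤ n, X i w = z i} ∩ {w | X (n + (m + 1)) w = y} =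
      ⋃ u, ({w | ∀ i ≤ n + 1, X i w = Function.update z (n + 1) u i} ∩
        {w | X (n + 1 + m) w = y}) := by
    ext w
    simp only [hcyl, Set.mem_iUnion, Set.mem_inter_iff, Set.mem_ofPred_eq]
    rw [show n + (m + 1) = n + 1 + m by ring]
    constructor
    · rintro ⟨h1, h2⟩
      exact ⟨_, ⟨h1, rfl⟩, h2⟩
    · rintro ⟨u, ⟨h1, -⟩, h2⟩
      exact ⟨h1, h2⟩
  rw [hun, measure_iUnion, ← ENNReal.tsum_mul_left]
  · refine tsum_congr fun u => ?_
    rw [ih, hX.markov a n (Function.update z (n + 1) u), Function.update_self,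
      Function.update_of_ne (by omega), mul_assoc]
    congr 2
    ext w
    refine forall₂_congr fun i hi => ?_
    rw [Function.update_of_ne (by omega)]
  · intro u v huv
    refine Set.disjoint_left.2 ?_
    rintro w ⟨h1, -⟩ ⟨h2, -⟩
    have h1 := h1 (n + 1) le_rfl
    have h2 := h2 (n + 1) le_rfl
    simp only [Function.update_self] at h1 h2
    exact huv (h1.symm.trans h2)
  · intro u
    exact (hX.measurableSet_cylinder _ _).inter (hX.measurableSet_eq _ _)

/-- The Markov property on cylinder events. -/
lemma cylinder (hX : IsMarkovChain P X) (m : ℕ) (y : Fin d → ℤ) :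
    ∀ (a : Fin d → ℤ) (n : ℕ) (z : ℕ → Fin d → ℤ),
      P a ({w | ∀ i ≤ n, X i w = z i} ∩ {w | X (n + m) w = y}) =
        P a {w | ∀ i ≤ n, X i w = z i} * P (z n) {w | X m w = y} := by
  induction m with
  | zero =>
    intro a n z
    have := hX.isProb (z n)
    by_cases hy : y = z n
    · subst hy
      rw [hX.start, mul_one]
      congr 1
      ext w
      simp only [Set.mem_inter_iff, Set.mem_ofPred_eq, and_iff_left_iff_imp]
      exact fun h => h n le_rfl
    · have h0 : P (z n) {w | X 0 w = y} = 0 := by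
        have h1 : P (z n) {w | X 0 w = z n}ᶜ = 0 := by
          rw [prob_compl_eq_zero_iff (hX.measurableSet_eq _ _)]
          exact hX.start _
        refine measure_mono_null (fun w hw => ?_) h1
        intro h
        exact hy (hw.symm.trans h)
      rw [h0, mul_zero]
      convert measure_empty (μ := P a)
      ext w
      simp only [Set.mem_inter_iff, Set.mem_ofPred_eq, Set.mem_empty_iff_false, iff_false]
      rintro ⟨h1, h2⟩
      exact hy (h2.symm.trans (h1 n le_rfl))
  | succ m ih =>
    intro a n z
    rw [hX.cylinder_step ih]
    congr 1
    have h := hX.cylinder_step ih (z n) 0 (fun _ => z n)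
    have h1 : {w | ∀ i ≤ 0, X i w = z n} = {w | X 0 w = z n} := by ext; simp
    rw [h1, hX.start, one_mul] at h
    rw [← h, zero_add]
    have := hX.isProb (z n)
    have h2 : ∀ᵐ w ∂(P (z n)), X 0 w = z n := by
      rw [ae_iff]
      exact (prob_compl_eq_zero_iff (hX.measurableSet_eq _ _)).2 (hX.start _)
    refine measure_congr (Filter.eventuallyEq_set.2 ?_)
    filter_upwards [h2] with w hw
    simp [hw]

/-- The Markov property at a fixed time, for events that depend on the path up to that time. -/
lemma path_event (hX : IsMarkovChain P X) (a x y : Fin d → ℤ) (n m : ℕ)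
    (B : Set (Fin (n + 1) → Fin d → ℤ)) (hB : ∀ z ∈ B, z (Fin.last n) = x) :
    P a ({w | (fun i : Fin (n + 1) => X i w) ∈ B} ∩ {w | X (n + m) w = y}) =
      P a {w | (fun i : Fin (n + 1) => X i w) ∈ B} * P x {w | X m w = y} := by
  have hm : Measurable (fun w (i : Fin (n + 1)) => X i w) :=
    measurable_pi_lambda _ fun i => hX.measurable i
  have hBm : MeasurableSet B := B.to_countable.measurableSet
  -- There are only countably many paths of length n + 1, so the event is a countable disjoint union
  -- of cylinders.
  have hdec : ∀ D : Set A, MeasurableSet D →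
      P a ({w | (fun i : Fin (n + 1) => X i w) ∈ B} ∩ D) =
        ∑' z : B, P a ({w | (fun i : Fin (n + 1) => X i w) = z} ∩ D) := by
    intro D hD
    rw [← measure_iUnion]
    · congr 1
      ext w
      simp
    · intro u v huv
      refine Set.disjoint_left.2 ?_
      rintro w ⟨h1, -⟩ ⟨h2, -⟩
      exact huv (Subtype.ext (h1.symm.trans h2))
    · intro z
      exact (hm (measurableSet_singleton _)).inter hD
  have hdec' := hdec Set.univ MeasurableSet.univ
  simp only [Set.inter_univ] at hdec'
  rw [hdec _ (hX.measurableSet_eq _ _), hdec', ← ENNReal.tsum_mul_right]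
  refine tsum_congr fun z => ?_
  have h := hX.cylinder m y a n (fun i => if h : i < n + 1 then z.1 ⟨i, h⟩ else 0)
  have hz : (if h : n < n + 1 then z.1 ⟨n, h⟩ else 0) = x := by
    rw [dif_pos (Nat.lt_succ_self n)]
    exact hB z.1 z.2
  have hs : {w | ∀ i ≤ n, X i w = if h : i < n + 1 then z.1 ⟨i, h⟩ else 0} =
      {w | (fun i : Fin (n + 1) => X i w) = z} := by
    ext w
    simp only [Set.mem_ofPred_eq, funext_iff (f := fun i : Fin (n + 1) => X i w)]
    constructor
    · intro h i
      have := h i (by omega)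
      rwa [dif_pos i.2] at this
    · intro h i hi
      rw [dif_pos (by omega)]
      exact h ⟨i, by omega⟩
  rw [hz, hs] at h
  exact h

end IsMarkovChain

end Chain

/-! ### Occupation times, first hits and the Green function -/

section Occupation

variable {d : ℕ} {A : Type*} [MeasurableSpace A]
  {P : (Fin d → ℤ) → Measure A} {X : ℕ → A → (Fin d → ℤ)}

/-- The number of visits to `y`. -/
noncomputable def occupation (X : ℕ → A → (Fin d → ℤ)) (y : Fin d → ℤ) (w : A) : ℝ≥0∞ :=
  ∑' n, {w | X n w = y}.indicator 1 w

/-- The event that `G` is visited for the first time at time `n`, in the point `x`. -/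
def firstHit (X : ℕ → A → (Fin d → ℤ)) (G : Set (Fin d → ℤ)) (n : ℕ) (x : Fin d → ℤ) : Set A :=
  {w | X n w = x ∧ x ∈ G ∧ ∀ i < n, X i w ∉ G}

/-- The indicator of the event that `x` is the first point of `G` that is visited. -/
noncomputable def hitAt (X : ℕ → A → (Fin d → ℤ)) (G : Set (Fin d → ℤ)) (x : Fin d → ℤ) (w : A) :
    ℝ≥0∞ :=
  ∑' n, (firstHit X G n x).indicator 1 w

lemma measurable_occupation (hX : IsMarkovChain P X) (y : Fin d → ℤ) :
    Measurable (occupation X y) :=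
  .tsum fun n => measurable_one.indicator (hX.measurableSet_eq n y)

lemma firstHit_eq_path (G : Set (Fin d → ℤ)) (n : ℕ) (x : Fin d → ℤ) :
    firstHit X G n x = {w | (fun i : Fin (n + 1) => X i w) ∈
      {z : Fin (n + 1) → Fin d → ℤ | z (Fin.last n) = x ∧ x ∈ G ∧
        ∀ i : Fin (n + 1), i.1 < n → z i ∉ G}} := by
  ext w
  simp only [firstHit, Set.mem_ofPred_eq, Fin.val_last]
  exact and_congr_right fun _ => and_congr_right fun _ =>
    ⟨fun h i hi => h i hi, fun h i hi => h ⟨i, by omega⟩ hi⟩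

lemma measurableSet_path_event (hX : IsMarkovChain P X) (n : ℕ)
    (B : Set (Fin (n + 1) → Fin d → ℤ)) :
    MeasurableSet {w | (fun i : Fin (n + 1) => X i w) ∈ B} :=
  (measurable_pi_lambda _ fun i : Fin (n + 1) => hX.measurable i) B.to_countable.measurableSet

lemma measurableSet_firstHit (hX : IsMarkovChain P X) (G : Set (Fin d → ℤ)) (n : ℕ)
    (x : Fin d → ℤ) : MeasurableSet (firstHit X G n x) := by
  rw [firstHit_eq_path]
  exact measurableSet_path_event hX _ _

lemma measurable_hitAt (hX : IsMarkovChain P X) (G : Set (Fin d → ℤ)) (x : Fin d → ℤ) :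
    Measurable (hitAt X G x) :=
  .tsum fun n => measurable_one.indicator (measurableSet_firstHit hX G n x)

lemma lintegral_occupation (hX : IsMarkovChain P X) (a y : Fin d → ℤ) :
    ∫⁻ w, occupation X y w ∂P a = green P X a y := by
  unfold occupation green
  rw [lintegral_tsum fun n =>
    (measurable_one.indicator (hX.measurableSet_eq n y)).aemeasurable]
  exact tsum_congr fun n => lintegral_indicator_one (hX.measurableSet_eq n y)

lemma hitAt_of_notMem {G : Set (Fin d → ℤ)} {x : Fin d → ℤ} (hx : x ∉ G) (w : A) :
    hitAt X G x w = 0 := by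
  simp [hitAt, firstHit, hx]

lemma hitAt_le_occupation (G : Set (Fin d → ℤ)) (x : Fin d → ℤ) (w : A) :
    hitAt X G x w ≤ occupation X x w :=
  ENNReal.tsum_le_tsum fun _ =>
    Set.indicator_le_indicator_of_subset (fun _ h => h.1) (fun _ => zero_le) w

lemma lintegral_hitAt_le_green (hX : IsMarkovChain P X) (a : Fin d → ℤ) (G : Set (Fin d → ℤ))
    (x : Fin d → ℤ) : ∫⁻ w, hitAt X G x w ∂P a ≤ green P X a x := by
  rw [← lintegral_occupation hX]
  exact lintegral_mono fun w => hitAt_le_occupation G x w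

open Classical in
lemma sum_hitAt (G : Finset (Fin d → ℤ)) (w : A) :
    ∑ x ∈ G, hitAt X (G : Set (Fin d → ℤ)) x w = if ∃ n, X n w ∈ G then 1 else 0 := by
  unfold hitAt
  have hn : ∀ n, ∑ x ∈ G, (firstHit X (G : Set (Fin d → ℤ)) n x).indicator
      (1 : A → ℝ≥0∞) w = if X n w ∈ G ∧ ∀ i < n, X i w ∉ G then 1 else 0 := by
    intro n
    split_ifs with h
    · rw [Finset.sum_eq_single_of_mem _ h.1]
      · rw [Set.indicator_of_mem]
        · rfl
        · exact ⟨rfl, h.1, h.2⟩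
      · intro x hx hne
        rw [Set.indicator_of_notMem]
        exact fun h' => hne h'.1.symm
    · refine Finset.sum_eq_zero fun x hx => Set.indicator_of_notMem (fun h' => h ?_) _
      obtain ⟨h1, h2, h3⟩ := h'
      exact ⟨h1 ▸ h2, h3⟩
  rw [← Summable.tsum_finsetSum fun _ _ => ENNReal.summable]
  simp_rw [hn]
  split_ifs with h
  · rw [tsum_eq_single (Nat.find h)]
    · rw [if_pos ⟨Nat.find_spec h, fun i hi => Nat.find_min h hi⟩]
    · intro n hne
      rw [if_neg]
      rintro ⟨h1, h2⟩
      rcases lt_or_gt_of_ne hne with h3 | h3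
      · exact Nat.find_min h h3 h1
      · exact h2 _ h3 (Nat.find_spec h)
  · simp only [ENNReal.tsum_eq_zero]
    intro n
    rw [if_neg]
    exact fun h' => h ⟨n, h'.1⟩

/-- The strong Markov property at the first visit to `G`. -/
lemma lintegral_hitAt_mul_green_le (hX : IsMarkovChain P X) (a : Fin d → ℤ)
    (G : Set (Fin d → ℤ)) (x y : Fin d → ℤ) :
    (∫⁻ w, hitAt X G x w ∂P a) * green P X x y ≤
      ∫⁻ w, hitAt X G x w * occupation X y w ∂P a := by
  have hm := fun n => measurableSet_firstHit hX G n x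
  have hmarkov : ∀ n m, P a (firstHit X G n x ∩ {w | X (n + m) w = y}) =
      P a (firstHit X G n x) * P x {w | X m w = y} := by
    intro n m
    rw [firstHit_eq_path]
    exact hX.path_event a x y n m _ fun z hz => hz.1
  calc (∫⁻ w, hitAt X G x w ∂P a) * green P X x y
      = ∑' n, ∑' m, P a (firstHit X G n x ∩ {w | X (n + m) w = y}) := by
        unfold hitAt green
        rw [lintegral_tsum fun n => (measurable_one.indicator (hm n)).aemeasurable,
          ← ENNReal.tsum_mul_right]
        refine tsum_congr fun n => ?_
        rw [lintegral_indicator_one (hm n), ← ENNReal.tsum_mul_left]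
        exact tsum_congr fun m => (hmarkov n m).symm
    -- The left side counts only the visits to y from the hitting time on; admitting earlier visits
    -- can only increase the sum.
    _ ≤ ∑' n, ∑' m, P a (firstHit X G n x ∩ {w | X m w = y}) :=
        ENNReal.tsum_le_tsum fun n => ENNReal.tsum_comp_le_tsum_of_injective
          (add_right_injective n) (fun m => P a (firstHit X G n x ∩ {w | X m w = y}))
    _ = ∫⁻ w, hitAt X G x w * occupation X y w ∂P a := by
        have : ∀ w, hitAt X G x w * occupation X y w =
            ∑' n, ∑' m, (firstHit X G n x ∩ {w | X m w = y}).indicator 1 w := by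
          intro w
          unfold hitAt occupation
          rw [← ENNReal.tsum_mul_right]
          refine tsum_congr fun n => ?_
          rw [← ENNReal.tsum_mul_left]
          refine tsum_congr fun m => ?_
          rw [Set.inter_indicator_one, Pi.mul_apply]
        simp_rw [this]
        have hm2 := fun n m => (hm n).inter (hX.measurableSet_eq m y)
        rw [lintegral_tsum fun n => (Measurable.tsum fun m =>
          measurable_one.indicator (hm2 n m)).aemeasurable]
        refine tsum_congr fun n => ?_
        rw [lintegral_tsum fun m => (measurable_one.indicator (hm2 n m)).aemeasurable]
        exact tsum_congr fun m => (lintegral_indicator_one (hm2 n m)).symm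

lemma measure_visit_visit (hX : IsMarkovChain P X) (a x y : Fin d → ℤ) (n m : ℕ) :
    P a ({w | X n w = x} ∩ {w | X (n + m) w = y}) =
      P a {w | X n w = x} * P x {w | X m w = y} :=
  hX.path_event a x y n m {z | z (Fin.last n) = x} fun _ hz => hz

/-- Split the pairs of visit times by their order and apply the Markov property at the earlier time.
Equal times are counted twice, hence an inequality. -/
lemma lintegral_occupation_mul_le (hX : IsMarkovChain P X) (a x y : Fin d → ℤ) :
    ∫⁻ w, occupation X x w * occupation X y w ∂P a ≤
      green P X a x * green P X x y + green P X a y * green P X y x := by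
  have hm2 := fun n m => (hX.measurableSet_eq n x).inter (hX.measurableSet_eq m y)
  have h1 : ∀ w, occupation X x w * occupation X y w =
      ∑' n, ∑' m, ({w | X n w = x} ∩ {w | X m w = y}).indicator 1 w := by
    intro w
    unfold occupation
    rw [← ENNReal.tsum_mul_right]
    refine tsum_congr fun n => ?_
    rw [← ENNReal.tsum_mul_left]
    refine tsum_congr fun m => ?_
    rw [Set.inter_indicator_one, Pi.mul_apply]
  have h2 : ∫⁻ w, occupation X x w * occupation X y w ∂P a =
      ∑' n, ∑' m, P a ({w | X n w = x} ∩ {w | X m w = y}) := by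
    simp_rw [h1]
    rw [lintegral_tsum fun n => (Measurable.tsum fun m =>
      measurable_one.indicator (hm2 n m)).aemeasurable]
    refine tsum_congr fun n => ?_
    rw [lintegral_tsum fun m => (measurable_one.indicator (hm2 n m)).aemeasurable]
    exact tsum_congr fun m => lintegral_indicator_one (hm2 n m)
  have hg : ∀ x y, green P X a x * green P X x y =
      ∑' n, ∑' m, P a ({w | X n w = x} ∩ {w | X (n + m) w = y}) := by
    intro x y
    unfold green
    rw [← ENNReal.tsum_mul_right]
    refine tsum_congr fun n => ?_
    rw [← ENNReal.tsum_mul_left]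
    exact tsum_congr fun m => (measure_visit_visit hX a x y n m).symm
  have hsplit : ∀ f : ℕ → ℕ → ℝ≥0∞, ∑' n, ∑' m, f n m ≤
      (∑' n, ∑' m, f n (n + m)) + ∑' n, ∑' m, f (n + m) n := by
    intro f
    have hle : ∀ n m, f n m ≤ (if n ≤ m then f n m else 0) + (if m ≤ n then f n m else 0) := by
      intro n m
      rcases le_total n m with h | h <;> simp [h]
    have hshift : ∀ (h : ℕ → ℝ≥0∞) (n : ℕ), ∑' m, (if n ≤ m then h m else 0) =
        ∑' m, h (n + m) := by
      intro h n
      rw [← Summable.sum_add_tsum_nat_add' (k := n) ENNReal.summable, Finset.sum_eq_zero, zero_add]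
      · exact tsum_congr fun m => by rw [if_pos (by omega), add_comm]
      · intro i hi
        rw [if_neg (by simpa using hi)]
    calc ∑' n, ∑' m, f n m
        ≤ ∑' n, ∑' m, ((if n ≤ m then f n m else 0) + (if m ≤ n then f n m else 0)) :=
          ENNReal.tsum_le_tsum fun n => ENNReal.tsum_le_tsum fun m => hle n m
      _ = (∑' n, ∑' m, if n ≤ m then f n m else 0) +
            ∑' m, ∑' n, if m ≤ n then f n m else 0 := by
          simp_rw [ENNReal.tsum_add]
          congr 1
          exact ENNReal.tsum_comm
      _ = _ := by
          congr 1
          · exact tsum_congr fun n => hshift (f n) n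
          · exact tsum_congr fun m => hshift (fun n => f n m) m
  rw [h2, hg, hg]
  refine (hsplit _).trans_eq ?_
  congr 1
  exact tsum_congr fun n => tsum_congr fun m => by rw [Set.inter_comm]

/-- The event that the first visit to `y` at a positive time takes place at time `k + 1`. -/
def firstReturn (X : ℕ → A → (Fin d → ℤ)) (y : Fin d → ℤ) (k : ℕ) : Set A :=
  {w | X (k + 1) w = y ∧ ∀ i < k, X (i + 1) w ≠ y}

lemma firstReturn_eq_path (y : Fin d → ℤ) (k : ℕ) :
    firstReturn X y k = {w | (fun i : Fin (k + 1 + 1) => X i w) ∈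
      {z : Fin (k + 1 + 1) → Fin d → ℤ | z (Fin.last (k + 1)) = y ∧
        ∀ i : Fin (k + 1 + 1), 0 < i.1 → i.1 < k + 1 → z i ≠ y}} := by
  ext w
  simp only [firstReturn, Set.mem_ofPred_eq, Fin.val_last]
  refine and_congr_right fun _ => ⟨fun h i hi1 hi2 => ?_, fun h i hi => ?_⟩
  · have := h (i.1 - 1) (by omega)
    rwa [Nat.sub_add_cancel hi1] at this
  · exact h ⟨i + 1, by omega⟩ (by simp) (by simpa using hi)

lemma measurableSet_firstReturn (hX : IsMarkovChain P X) (y : Fin d → ℤ) (k : ℕ) :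
    MeasurableSet (firstReturn X y k) := by
  rw [firstReturn_eq_path]
  exact measurableSet_path_event hX _ _

lemma disjoint_firstReturn (y : Fin d → ℤ) :
    Pairwise (Function.onFun Disjoint (firstReturn X y)) := by
  intro k l hkl
  refine Set.disjoint_left.2 ?_
  rintro w ⟨h1, h2⟩ ⟨h3, h4⟩
  rcases lt_or_gt_of_ne hkl with h | h
  · exact h4 _ h h1
  · exact h2 _ h h3

lemma measure_visit_eq_sum_firstReturn (hX : IsMarkovChain P X) (a y : Fin d → ℤ) (n : ℕ) :
    P a {w | X (n + 1) w = y} =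
      ∑ k ∈ Finset.range (n + 1), P a (firstReturn X y k) * P y {w | X (n - k) w = y} := by
  classical
  have hun : {w | X (n + 1) w = y} =
      ⋃ k ∈ Finset.range (n + 1), firstReturn X y k ∩ {w | X (k + 1 + (n - k)) w = y} := by
    ext w
    simp only [Set.mem_iUnion, Finset.mem_range, Set.mem_inter_iff, Set.mem_ofPred_eq]
    constructor
    · intro h
      have hex : ∃ k, X (k + 1) w = y := ⟨n, h⟩
      have hle : Nat.find hex ≤ n := Nat.find_le h
      refine ⟨Nat.find hex, by omega, ⟨Nat.find_spec hex, fun i hi => Nat.find_min hex hi⟩, ?_⟩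
      rwa [show Nat.find hex + 1 + (n - Nat.find hex) = n + 1 by omega]
    · rintro ⟨k, hk, -, h⟩
      rwa [show k + 1 + (n - k) = n + 1 by omega] at h
  rw [hun, measure_biUnion_finset]
  · refine Finset.sum_congr rfl fun k _ => ?_
    rw [firstReturn_eq_path]
    exact hX.path_event a y y (k + 1) (n - k) _ fun z hz => hz.1
  · intro k _ l _ hkl
    exact (disjoint_firstReturn y hkl).mono Set.inter_subset_left Set.inter_subset_left
  · exact fun k _ => (measurableSet_firstReturn hX y k).inter (hX.measurableSet_eq _ _)

/-- The renewal equation at the first positive visit to y, in truncated form: the sums are finite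
and may be subtracted later. The 1 accounts for time 0. -/
lemma sum_measure_visit_le (hX : IsMarkovChain P X) (a y : Fin d → ℤ) (N : ℕ) :
    ∑ n ∈ Finset.range N, P a {w | X n w = y} ≤
      1 + P a {w | ∃ n, 1 ≤ n ∧ X n w = y} *
        ∑ n ∈ Finset.range N, P y {w | X n w = y} := by
  have := hX.isProb a
  rcases N with _ | N
  · simp
  rw [Finset.sum_range_succ', add_comm]
  refine add_le_add prob_le_one ?_
  simp_rw [measure_visit_eq_sum_firstReturn hX a y]
  rw [Finset.sum_range_diag_flip N fun k m => P a (firstReturn X y k) * P y {w | X m w = y}]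
  simp_rw [← Finset.mul_sum]
  calc ∑ k ∈ Finset.range N, P a (firstReturn X y k) *
        ∑ m ∈ Finset.range (N - k), P y {w | X m w = y}
      ≤ ∑ k ∈ Finset.range N, P a (firstReturn X y k) *
        ∑ m ∈ Finset.range (N + 1), P y {w | X m w = y} := by
        refine Finset.sum_le_sum fun k _ => mul_le_mul_right (Finset.sum_le_sum_of_subset ?_) _
        exact Finset.range_mono (by omega)
    _ = (∑ k ∈ Finset.range N, P a (firstReturn X y k)) *
        ∑ m ∈ Finset.range (N + 1), P y {w | X m w = y} := by rw [Finset.sum_mul]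
    _ ≤ _ := by
        refine mul_le_mul_left ?_ _
        rw [← measure_biUnion_finset (fun k _ l _ hkl => disjoint_firstReturn y hkl)
          fun k _ => measurableSet_firstReturn hX y k]
        refine measure_mono (Set.iUnion₂_subset fun k _ w hw => ?_)
        exact ⟨k + 1, by omega, hw.1⟩

/-- With return probability r < 1, each partial sum S satisfies S ≤ 1 + rS, so all of them are at
most 1/(1 − r). -/
lemma green_self_ne_top (hX : IsMarkovChain P X) (hT : IsTransient P X) (y : Fin d → ℤ) :
    green P X y y ≠ ∞ := by
  have := hX.isProb y
  set r := P y {w | ∃ n, 1 ≤ n ∧ X n w = y} with hr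
  have hr1 : r < 1 := hT y
  have hfin : (1 - r)⁻¹ ≠ ∞ := ENNReal.inv_ne_top.2 (tsub_pos_of_lt hr1).ne'
  refine ne_top_of_le_ne_top hfin ?_
  unfold green
  rw [ENNReal.tsum_eq_iSup_nat]
  refine iSup_le fun N => ?_
  set S := ∑ n ∈ Finset.range N, P y {w | X n w = y} with hS
  have hSfin : S ≠ ∞ := ENNReal.sum_ne_top.2 fun n _ => measure_ne_top _ _
  have h : S ≤ 1 + r * S := sum_measure_visit_le hX y y N
  have h2 : (1 - r) * S ≤ 1 := by
    rw [ENNReal.sub_mul fun _ _ => hSfin, one_mul]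
    exact tsub_le_iff_right.2 h
  rw [← one_div, ENNReal.le_div_iff_mul_le (Or.inl (tsub_pos_of_lt hr1).ne')
    (Or.inl (ENNReal.sub_ne_top ENNReal.one_ne_top)), mul_comm]
  exact h2

lemma green_ne_top (hX : IsMarkovChain P X) (hT : IsTransient P X) (a y : Fin d → ℤ) :
    green P X a y ≠ ∞ := by
  have := hX.isProb a
  have hfin : 1 + green P X y y ≠ ∞ :=
    ENNReal.add_ne_top.2 ⟨ENNReal.one_ne_top, green_self_ne_top hX hT y⟩
  refine ne_top_of_le_ne_top hfin ?_
  conv_lhs => unfold green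
  rw [ENNReal.tsum_eq_iSup_nat]
  refine iSup_le fun N => (sum_measure_visit_le hX a y N).trans ?_
  refine add_le_add le_rfl ?_
  calc _ ≤ 1 * ∑ n ∈ Finset.range N, P y {w | X n w = y} := mul_le_mul_left prob_le_one _
    _ ≤ green P X y y := by
      rw [one_mul]
      exact ENNReal.sum_le_tsum _

end Occupation

lemma two_mul_mul_le_sq_add_sq (a b : ℝ≥0∞) : 2 * (a * b) ≤ a ^ 2 + b ^ 2 := by
  rcases eq_or_ne a ∞ with rfl | ha
  · simp
  rcases eq_or_ne b ∞ with rfl | hb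
  · simp
  lift a to NNReal using ha
  lift b to NNReal using hb
  rw [← mul_assoc]
  exact_mod_cast two_mul_le_add_sq a b

/-! ### Conditional expectations for finitely many independent coordinates -/

section FinitePercolation

open Classical in
/-- The indicator of the event that all coordinates in `T` are kept. -/
noncomputable def allKept {κ : Type*} (T : Finset κ) (s : κ → Bool) : ℝ≥0∞ :=
  if ∀ c ∈ T, s c = true then 1 else 0

variable {κ : Type*} [Fintype κ] [DecidableEq κ] (β : Measure Bool) [IsProbabilityMeasure β]

/-- The conditional expectation, for the product measure, given the coordinates in `T`. -/
noncomputable def condOn (T : Finset κ) (f : (κ → Bool) → ℝ≥0∞) : (κ → Bool) → ℝ≥0∞ :=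
  lmarginal (fun _ => β) Tᶜ f

lemma condOn_congr (T : Finset κ) (f : (κ → Bool) → ℝ≥0∞) {s t : κ → Bool}
    (h : ∀ c ∈ T, s c = t c) : condOn β T f s = condOn β T f t :=
  lmarginal_congr _ f fun i hi => h i (by simpa using hi)

lemma condOn_mono (T : Finset κ) {f h : (κ → Bool) → ℝ≥0∞} (hfh : f ≤ h) :
    condOn β T f ≤ condOn β T h :=
  lmarginal_mono hfh

lemma condOn_mul_left (T : Finset κ) (f h : (κ → Bool) → ℝ≥0∞)
    (hf : ∀ s t : κ → Bool, (∀ c ∈ T, s c = t c) → f s = f t) :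
    condOn β T (fun s => f s * h s) = fun s => f s * condOn β T h s := by
  ext s
  unfold condOn lmarginal
  rw [← lintegral_const_mul _ (Measurable.of_discrete)]
  refine lintegral_congr fun y => ?_
  dsimp only
  congr 1
  refine hf _ _ fun c hc => ?_
  simp [Function.updateFinset, hc]

lemma lintegral_condOn (T : Finset κ) (f : (κ → Bool) → ℝ≥0∞) :
    ∫⁻ s, condOn β T f s ∂Measure.pi (fun _ => β) = ∫⁻ s, f s ∂Measure.pi (fun _ => β) := by
  rw [lintegral_eq_lmarginal_univ (fun _ => true), lintegral_eq_lmarginal_univ (fun _ => true)]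
  rw [← Finset.union_compl T, lmarginal_union _ f Measurable.of_discrete disjoint_compl_right,
    lmarginal_union _ _ Measurable.of_discrete disjoint_compl_right]
  congr 1
  change condOn β T (condOn β T f) = condOn β T f
  have := condOn_mul_left β T (condOn β T f) 1 fun s t h => condOn_congr β T f h
  simp only [Pi.one_apply, mul_one] at this
  rw [this]
  ext s
  simp [condOn, lmarginal]

lemma lintegral_condOn_mul (T : Finset κ) (f h : (κ → Bool) → ℝ≥0∞) :
    ∫⁻ s, condOn β T f s * h s ∂Measure.pi (fun _ => β) =
      ∫⁻ s, condOn β T f s * condOn β T h s ∂Measure.pi (fun _ => β) := by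
  rw [← lintegral_condOn β T fun s => condOn β T f s * h s]
  rw [condOn_mul_left β T _ _ fun s t h => condOn_congr β T f h]

/-- Self-adjointness of conditional expectation, used to move the conditioning from the hitting
event to the survival of a second point. -/
lemma lintegral_mul_condOn (T : Finset κ) (f h : (κ → Bool) → ℝ≥0∞) :
    ∫⁻ s, f s * condOn β T h s ∂Measure.pi (fun _ => β) =
      ∫⁻ s, condOn β T f s * h s ∂Measure.pi (fun _ => β) := by
  rw [lintegral_condOn_mul]
  simp_rw [mul_comm (f _), mul_comm (condOn β T f _)]
  exact lintegral_condOn_mul β T h f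

lemma lintegral_condOn_mul_condOn {T T' : Finset κ} (hT : T ⊆ T') (f h : (κ → Bool) → ℝ≥0∞) :
    ∫⁻ s, condOn β T f s * condOn β T' h s ∂Measure.pi (fun _ => β) =
      ∫⁻ s, condOn β T f s * h s ∂Measure.pi (fun _ => β) := by
  rw [← lintegral_condOn β T' fun s => condOn β T f s * h s,
    condOn_mul_left β T' _ _ fun s t h => condOn_congr β T f fun c hc => h c (hT hc)]

/-- The dual form of Doob's maximal inequality in `L²`, for conditional expectations along a
chain of sets of coordinates. -/
lemma lintegral_sum_condOn_sq_le {ι : Type*} (F : Finset ι) (T : ι → Finset κ)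
    (hT : ∀ x y, T x ⊆ T y ∨ T y ⊆ T x) (φ : ι → (κ → Bool) → ℝ≥0∞) (hφ : ∀ x s, φ x s ≤ 1) :
    ∫⁻ s, (∑ x ∈ F, condOn β (T x) (φ x) s) ^ 2 ∂Measure.pi (fun _ => β) ≤
      4 * ∫⁻ s, (∑ x ∈ F, φ x s) ^ 2 ∂Measure.pi (fun _ => β) := by
  set μ : Measure (κ → Bool) := Measure.pi fun _ => β with hμ
  set S : (κ → Bool) → ℝ≥0∞ := fun s => ∑ x ∈ F, condOn β (T x) (φ x) s with hS
  set Φ : (κ → Bool) → ℝ≥0∞ := fun s => ∑ x ∈ F, φ x s with hΦ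
  have hm : ∀ f : (κ → Bool) → ℝ≥0∞, Measurable f := fun f => Measurable.of_discrete
  have hone : ∀ x s, condOn β (T x) (φ x) s ≤ 1 := by
    intro x s
    refine (condOn_mono β (T x) (h := 1) (hφ x) s).trans_eq ?_
    simp [condOn, lmarginal]
  -- Finiteness allows one copy of the integral of S² to be cancelled at the end.
  have hfin : ∫⁻ s, S s ^ 2 ∂μ ≠ ∞ := by
    refine ne_top_of_le_ne_top (b := (F.card : ℝ≥0∞) ^ 2) (by finiteness) ?_
    calc ∫⁻ s, S s ^ 2 ∂μ ≤ ∫⁻ _, (F.card : ℝ≥0∞) ^ 2 ∂μ := by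
          refine lintegral_mono fun s => ?_
          have : S s ≤ F.card := by
            simpa using Finset.sum_le_card_nsmul F _ 1 fun x _ => hone x s
          gcongr
      _ = _ := by simp
  -- The factor conditioned on the smaller set is constant for the larger conditioning, which can be
  -- dropped. Adding the other term makes the bound symmetric in x and y.
  have hpair : ∀ x y, ∫⁻ s, condOn β (T x) (φ x) s * condOn β (T y) (φ y) s ∂μ ≤
      ∫⁻ s, condOn β (T x) (φ x) s * φ y s ∂μ + ∫⁻ s, condOn β (T y) (φ y) s * φ x s ∂μ := by
    intro x y
    rcases hT x y with h | h
    · rw [lintegral_condOn_mul_condOn β h]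
      exact le_self_add
    · simp_rw [mul_comm (condOn β (T x) (φ x) _) (condOn β (T y) (φ y) _)]
      rw [lintegral_condOn_mul_condOn β h]
      exact le_add_self
  have hsq : ∫⁻ s, S s ^ 2 ∂μ ≤ 2 * ∫⁻ s, S s * Φ s ∂μ := by
    have e1 : ∀ s, S s ^ 2 =
        ∑ x ∈ F, ∑ y ∈ F, condOn β (T x) (φ x) s * condOn β (T y) (φ y) s := by
      intro s
      rw [sq, Finset.sum_mul_sum]
    have e2 : ∫⁻ s, S s * Φ s ∂μ =
        ∑ x ∈ F, ∑ y ∈ F, ∫⁻ s, condOn β (T x) (φ x) s * φ y s ∂μ := by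
      simp_rw [hS, hΦ, Finset.sum_mul_sum]
      rw [lintegral_finsetSum _ fun _ _ => hm _]
      exact Finset.sum_congr rfl fun x _ => lintegral_finsetSum _ fun _ _ => hm _
    simp_rw [e1]
    rw [lintegral_finsetSum _ fun _ _ => hm _]
    calc _ = ∑ x ∈ F, ∑ y ∈ F,
          ∫⁻ s, condOn β (T x) (φ x) s * condOn β (T y) (φ y) s ∂μ :=
          Finset.sum_congr rfl fun x _ => lintegral_finsetSum _ fun _ _ => hm _
      _ ≤ ∑ x ∈ F, ∑ y ∈ F, (∫⁻ s, condOn β (T x) (φ x) s * φ y s ∂μ +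
            ∫⁻ s, condOn β (T y) (φ y) s * φ x s ∂μ) :=
          Finset.sum_le_sum fun x _ => Finset.sum_le_sum fun y _ => hpair x y
      _ = 2 * ∫⁻ s, S s * Φ s ∂μ := by
          rw [e2, two_mul]
          simp_rw [Finset.sum_add_distrib]
          congr 1
          exact Finset.sum_comm
  have hamgm : ∀ s, 2 * (2 * (S s * Φ s)) ≤ S s ^ 2 + 4 * Φ s ^ 2 := by
    intro s
    have := two_mul_mul_le_sq_add_sq (S s) (2 * Φ s)
    rw [mul_pow] at this
    norm_num at this
    rwa [mul_left_comm (S s)] at this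
  have h1 : 2 * ∫⁻ s, S s ^ 2 ∂μ ≤ ∫⁻ s, S s ^ 2 ∂μ + 4 * ∫⁻ s, Φ s ^ 2 ∂μ := by
    calc 2 * ∫⁻ s, S s ^ 2 ∂μ ≤ 2 * (2 * ∫⁻ s, S s * Φ s ∂μ) := mul_le_mul_right hsq 2
      _ = ∫⁻ s, 2 * (2 * (S s * Φ s)) ∂μ := by
        rw [lintegral_const_mul _ (hm _), lintegral_const_mul _ (hm _)]
      _ ≤ ∫⁻ s, (S s ^ 2 + 4 * Φ s ^ 2) ∂μ := lintegral_mono hamgm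
      _ = _ := by rw [lintegral_add_left (hm _), lintegral_const_mul _ (hm _)]
  rw [two_mul] at h1
  exact (ENNReal.add_le_add_iff_left hfin).1 h1

/-- The conditional probability that the coordinates in `R` are kept. -/
lemma condOn_allKept (T R : Finset κ) (s : κ → Bool) :
    condOn β T (allKept R) s = allKept (R ∩ T) s * β {true} ^ (R \ T).card := by
  have h1 : ∀ y : (i : (Tᶜ : Finset κ)) → Bool,
      allKept R (Function.updateFinset s Tᶜ y) = allKept (R ∩ T) s *
        (Set.pi Set.univ fun c : (Tᶜ : Finset κ) =>
          if c.1 ∈ R then {true} else Set.univ).indicator 1 y := by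
    intro y
    have h2 : (∀ c ∈ R, Function.updateFinset s Tᶜ y c = true) ↔
        (∀ c ∈ R ∩ T, s c = true) ∧ y ∈ (Set.pi Set.univ fun c : (Tᶜ : Finset κ) =>
          if c.1 ∈ R then {true} else (Set.univ : Set Bool)) := by
      constructor
      · intro h
        refine ⟨fun c hc => ?_, fun c _ => ?_⟩
        · have := h c (Finset.mem_inter.1 hc).1
          simpa [Function.updateFinset, (Finset.mem_inter.1 hc).2] using this
        · dsimp only
          split_ifs with hc
          · have := h c hc
            rwa [Function.updateFinset, dif_pos c.2] at this
          · trivial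
      · rintro ⟨h1, h2⟩ c hc
        by_cases hcT : c ∈ T
        · simpa [Function.updateFinset, hcT] using h1 c (Finset.mem_inter.2 ⟨hc, hcT⟩)
        · have h3 := h2 ⟨c, by simpa using hcT⟩ trivial
          simp only [hc, if_true, Set.mem_singleton_iff] at h3
          simpa [Function.updateFinset, hcT] using h3
    unfold allKept
    by_cases h3 : ∀ c ∈ R ∩ T, s c = true
    · by_cases h4 : y ∈ (Set.pi Set.univ fun c : (Tᶜ : Finset κ) =>
          if c.1 ∈ R then {true} else (Set.univ : Set Bool))
      · rw [if_pos (h2.2 ⟨h3, h4⟩), if_pos h3, Set.indicator_of_mem h4]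
        simp
      · rw [if_neg fun h => h4 (h2.1 h).2, Set.indicator_of_notMem h4, mul_zero]
    · rw [if_neg fun h => h3 (h2.1 h).1, if_neg h3, zero_mul]
  unfold condOn lmarginal
  simp_rw [h1]
  rw [lintegral_const_mul _ Measurable.of_discrete, lintegral_indicator_one (.of_discrete),
    Measure.pi_pi]
  congr 1
  calc ∏ c : (Tᶜ : Finset κ), β (if c.1 ∈ R then {true} else Set.univ)
      = ∏ c ∈ Tᶜ, if c ∈ R then β {true} else 1 := by
        rw [← Finset.prod_coe_sort Tᶜ]
        refine Finset.prod_congr rfl fun c _ => ?_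
        split_ifs
        · rfl
        · exact measure_univ
    _ = _ := by
        rw [Finset.prod_ite, Finset.prod_const_one, mul_one, Finset.prod_const]
        congr 2
        ext c
        simp [and_comm]

lemma lintegral_allKept (R : Finset κ) :
    ∫⁻ s, allKept R s ∂Measure.pi (fun _ => β) = β {true} ^ R.card := by
  rw [← lintegral_condOn β ∅]
  simp_rw [condOn_allKept]
  simp [allKept]

end FinitePercolation

/-- The points of `F` all of whose ancestors are kept. -/
def survivors {d : ℕ} {κ : Type*} (anc : (Fin d → ℤ) → Finset κ) (F : Finset (Fin d → ℤ))
    (s : κ → Bool) : Finset (Fin d → ℤ) :=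
  {x ∈ F | ∀ c ∈ anc x, s c = true}

lemma mem_survivors {d : ℕ} {κ : Type*} {anc : (Fin d → ℤ) → Finset κ} {F : Finset (Fin d → ℤ)}
    {s : κ → Bool} {x : Fin d → ℤ} :
    x ∈ survivors anc F s ↔ x ∈ F ∧ ∀ c ∈ anc x, s c = true :=
  Finset.mem_filter

lemma survivors_subset {d : ℕ} {κ : Type*} (anc : (Fin d → ℤ) → Finset κ)
    (F : Finset (Fin d → ℤ)) (s : κ → Bool) : survivors anc F s ⊆ F :=
  Finset.filter_subset _ F

/-! ### Hitting the percolation: the second moment bound -/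

section HittingPercolation

variable {d : ℕ} {A : Type*} [MeasurableSpace A]
  {P : (Fin d → ℤ) → Measure A} {X : ℕ → A → (Fin d → ℤ)}
  {κ : Type*} [Fintype κ] [DecidableEq κ] (β : Measure Bool) [IsProbabilityMeasure β]
  (anc : (Fin d → ℤ) → Finset κ) (F : Finset (Fin d → ℤ))

/-- The energy of a mass distribution on `F`, for the tree structure given by the ancestors. -/
noncomputable def treeEnergy (g : (Fin d → ℤ) → (Fin d → ℤ) → ℝ≥0∞) (θ : ℝ≥0∞)
    (a : Fin d → ℤ) (μ : (Fin d → ℤ) → ℝ≥0∞) : ℝ≥0∞ :=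
  ∑ x ∈ F, ∑ y ∈ F, g x y / g a y * θ⁻¹ ^ (anc x ∩ anc y).card * μ x * μ y

/-- The probability that the chain started in `a` visits `G`. -/
noncomputable def hitProb (P : (Fin d → ℤ) → Measure A) (X : ℕ → A → (Fin d → ℤ))
    (a : Fin d → ℤ) (G : Finset (Fin d → ℤ)) : ℝ≥0∞ :=
  P a {w | ∃ n, X n w ∈ G}

/-- The weight of `y` in the second moment method. -/
noncomputable def weight (g : (Fin d → ℤ) → (Fin d → ℤ) → ℝ≥0∞) (θ : ℝ≥0∞) (a : Fin d → ℤ)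
    (μ : (Fin d → ℤ) → ℝ≥0∞) (y : Fin d → ℤ) : ℝ≥0∞ :=
  μ y / g a y * θ⁻¹ ^ (anc y).card

/-- The weighted occupation measure of the surviving points. -/
noncomputable def weightedOccupation (X : ℕ → A → (Fin d → ℤ)) (b : (Fin d → ℤ) → ℝ≥0∞)
    (s : κ → Bool) (w : A) : ℝ≥0∞ :=
  ∑ y ∈ F, b y * (occupation X y w * allKept (anc y) s)

lemma lintegral_pi_swap (m : Measure A) [SFinite m] {f : (κ → Bool) → A → ℝ≥0∞}
    (hf : ∀ s, Measurable (f s)) :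
    ∫⁻ w, ∫⁻ s, f s w ∂Measure.pi (fun _ => β) ∂m =
      ∫⁻ s, ∫⁻ w, f s w ∂m ∂Measure.pi (fun _ => β) := by
  refine (lintegral_lintegral_swap (f := f) ?_).symm
  exact (measurable_from_prod_countable_right hf).aemeasurable

lemma measurableSet_hit (hX : IsMarkovChain P X) (G : Finset (Fin d → ℤ)) :
    MeasurableSet {w | ∃ n, X n w ∈ G} := by
  have : {w | ∃ n, X n w ∈ G} = ⋃ n, X n ⁻¹' (G : Set (Fin d → ℤ)) := by
    ext w
    simp
  rw [this]
  exact .iUnion fun n => hX.measurable n G.measurableSet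

lemma measurable_weightedOccupation (hX : IsMarkovChain P X) (b : (Fin d → ℤ) → ℝ≥0∞)
    (s : κ → Bool) : Measurable (weightedOccupation anc F X b s) :=
  Finset.measurable_sum _ fun y _ =>
    ((measurable_occupation hX y).mul_const _).const_mul _

lemma allKept_mul (R T : Finset κ) (s : κ → Bool) :
    allKept R s * allKept T s = allKept (R ∪ T) s := by
  unfold allKept
  by_cases h1 : ∀ c ∈ R, s c = true
  · by_cases h2 : ∀ c ∈ T, s c = true
    · rw [if_pos h1, if_pos h2, if_pos, mul_one]
      intro c hc
      exact (Finset.mem_union.1 hc).elim (h1 c) (h2 c)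
    · rw [if_neg h2, mul_zero, if_neg]
      exact fun h => h2 fun c hc => h c (Finset.mem_union_right _ hc)
  · rw [if_neg h1, zero_mul, if_neg]
    exact fun h => h1 fun c hc => h c (Finset.mem_union_left _ hc)

lemma inv_pow_mul_pow {θ : ℝ≥0∞} (h0 : θ ≠ 0) (h1 : θ ≠ ∞) {k m n : ℕ} (h : n + k = m) :
    θ⁻¹ ^ m * θ ^ n = θ⁻¹ ^ k := by
  rw [← h, pow_add, mul_right_comm, ← mul_pow, ENNReal.inv_mul_cancel h0 h1, one_pow, one_mul]

lemma weight_mul_pow (g : (Fin d → ℤ) → (Fin d → ℤ) → ℝ≥0∞) {θ : ℝ≥0∞} (h0 : θ ≠ 0)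
    (h1 : θ ≠ ∞) (a : Fin d → ℤ) (μ : (Fin d → ℤ) → ℝ≥0∞) (y : Fin d → ℤ) {n k : ℕ}
    (h : n + k = (anc y).card) :
    weight anc g θ a μ y * θ ^ n = μ y / g a y * θ⁻¹ ^ k := by
  rw [weight, mul_assoc, inv_pow_mul_pow h0 h1 h]

/-- The second moment of the weighted occupation measure is bounded by the energy. -/
lemma lintegral_weightedOccupation_sq_le (hX : IsMarkovChain P X) (hT : IsTransient P X)
    (a : Fin d → ℤ) (hβ : β {true} ≠ 0) (μ : (Fin d → ℤ) → ℝ≥0∞)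
    (hμ : ∀ y ∈ F, green P X a y = 0 → μ y = 0) :
    ∫⁻ s, ∫⁻ w, weightedOccupation anc F X (weight anc (green P X) (β {true}) a μ) s w ^ 2 ∂P a
        ∂Measure.pi (fun _ => β) ≤
      2 * treeEnergy anc F (green P X) (β {true}) a μ := by
  set θ := β {true} with hθ
  have hθ1 : θ ≠ ∞ := measure_ne_top _ _
  set g := green P X with hg
  set b := weight anc g θ a μ with hb
  have hm := fun y => measurable_occupation hX y
  -- In the joint survival probability of x and y, the ancestors of x cancel the normalisation of `b
  -- x` completely. The remaining ancestors of y cancel that of `b y` up to the common ones.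
  have hpair : ∀ x ∈ F, ∀ y ∈ F,
      b x * b y * (g a x * g x y) * θ ^ (anc x ∪ anc y).card =
        g x y / g a y * θ⁻¹ ^ (anc x ∩ anc y).card * μ x * μ y := by
    intro x hx y hy
    have hcard : (anc x ∪ anc y).card = (anc x).card + (anc y \ anc x).card := by
      rw [← Finset.union_sdiff_self_eq_union, Finset.card_union_of_disjoint
        Finset.disjoint_sdiff]
    have h1 : b x * θ ^ (anc x).card * g a x = μ x := by
      rw [hb, weight_mul_pow anc g hβ hθ1 a μ x (k := 0) (by simp), pow_zero, mul_one]
      by_cases h : g a x = 0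
      · simp [hμ x hx h]
      · exact ENNReal.div_mul_cancel h (green_ne_top hX hT a x)
    have h2 : b y * θ ^ (anc y \ anc x).card = μ y / g a y * θ⁻¹ ^ (anc x ∩ anc y).card := by
      rw [hb, weight_mul_pow anc g hβ hθ1 a μ y]
      rw [Finset.inter_comm, Finset.card_sdiff_add_card_inter]
    rw [hcard, pow_add]
    calc b x * b y * (g a x * g x y) * (θ ^ (anc x).card * θ ^ (anc y \ anc x).card)
        = (b x * θ ^ (anc x).card * g a x) * (b y * θ ^ (anc y \ anc x).card) * g x y := by ring
      _ = _ := by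
        rw [h1, h2, div_eq_mul_inv, div_eq_mul_inv]
        ring
  have hsq : ∀ s w, weightedOccupation anc F X b s w ^ 2 = ∑ x ∈ F, ∑ y ∈ F,
      b x * b y * (occupation X x w * occupation X y w) * allKept (anc x ∪ anc y) s := by
    intro s w
    rw [sq, weightedOccupation, Finset.sum_mul_sum]
    refine Finset.sum_congr rfl fun x _ => Finset.sum_congr rfl fun y _ => ?_
    rw [← allKept_mul]
    ring
  have hm2 : ∀ x y (c e : ℝ≥0∞), Measurable fun w =>
      c * (occupation X x w * occupation X y w) * e := fun x y c e =>
    (((hm x).mul (hm y)).const_mul _).mul_const _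
  have hm1 : ∀ x y, Measurable fun w => occupation X x w * occupation X y w :=
    fun x y => (hm x).mul (hm y)
  calc _ = ∑ x ∈ F, ∑ y ∈ F, b x * b y * (∫⁻ w, occupation X x w * occupation X y w ∂P a) *
          θ ^ (anc x ∪ anc y).card := by
        simp_rw [hsq]
        simp_rw [lintegral_finsetSum F fun x _ => Finset.measurable_sum F fun y _ =>
          hm2 x y (b x * b y) _]
        rw [lintegral_finsetSum _ fun _ _ => .of_discrete]
        refine Finset.sum_congr rfl fun x _ => ?_
        simp_rw [lintegral_finsetSum F fun y _ => hm2 x y (b x * b y) _]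
        rw [lintegral_finsetSum _ fun _ _ => .of_discrete]
        refine Finset.sum_congr rfl fun y _ => ?_
        simp_rw [lintegral_mul_const _ ((hm1 x y).const_mul (b x * b y)),
          lintegral_const_mul _ (hm1 x y)]
        rw [lintegral_const_mul _ .of_discrete, lintegral_allKept]
    _ ≤ ∑ x ∈ F, ∑ y ∈ F, b x * b y * (g a x * g x y + g a y * g y x) *
          θ ^ (anc x ∪ anc y).card := by
        gcongr
        exact lintegral_occupation_mul_le hX a _ _
    _ = ∑ x ∈ F, ∑ y ∈ F, (g x y / g a y * θ⁻¹ ^ (anc x ∩ anc y).card * μ x * μ y +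
          g y x / g a x * θ⁻¹ ^ (anc y ∩ anc x).card * μ y * μ x) := by
        refine Finset.sum_congr rfl fun x hx => Finset.sum_congr rfl fun y hy => ?_
        rw [← hpair x hx y hy, ← hpair y hy x hx, Finset.union_comm (anc y)]
        ring
    _ = _ := by
        simp_rw [Finset.sum_add_distrib]
        rw [two_mul, treeEnergy]
        congr 1
        exact Finset.sum_comm

/-- Lower bound for the probability to hit the percolation, by the second moment method. -/
lemma inv_two_mul_treeEnergy_le (hX : IsMarkovChain P X) (hT : IsTransient P X)
    (a : Fin d → ℤ) (hβ : β {true} ≠ 0) (μ : (Fin d → ℤ) → ℝ≥0∞)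
    (hμ : ∀ y ∈ F, green P X a y = 0 → μ y = 0) (hμ1 : ∑ y ∈ F, μ y = 1) :
    (2 * treeEnergy anc F (green P X) (β {true}) a μ)⁻¹ ≤
      ∫⁻ s, hitProb P X a (survivors anc F s) ∂Measure.pi (fun _ => β) := by
  classical
  have := hX.isProb a
  have hZ2 := lintegral_weightedOccupation_sq_le β anc F hX hT a hβ μ hμ
  set θ := β {true} with hθ
  have hθ1 : θ ≠ ∞ := measure_ne_top _ _
  set g := green P X with hg
  set b := weight anc g θ a μ with hb
  set Z := weightedOccupation anc F X b with hZ
  set J := 2 * treeEnergy anc F g θ a μ with hJ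
  set M := ∫⁻ s, hitProb P X a (survivors anc F s) ∂Measure.pi (fun _ => β) with hM
  have hZm : ∀ s, Measurable (Z s) := fun s => measurable_weightedOccupation anc F hX b s
  have hmean : ∫⁻ s, ∫⁻ w, Z s w ∂P a ∂Measure.pi (fun _ => β) = 1 := by
    have h1 : ∀ s, ∫⁻ w, Z s w ∂P a = ∑ y ∈ F, b y * (g a y * allKept (anc y) s) := by
      intro s
      rw [hZ]
      unfold weightedOccupation
      rw [lintegral_finsetSum F fun y _ => ((measurable_occupation hX y).mul_const _).const_mul _]
      refine Finset.sum_congr rfl fun y _ => ?_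
      rw [lintegral_const_mul _ ((measurable_occupation hX y).mul_const _),
        lintegral_mul_const _ (measurable_occupation hX y), lintegral_occupation hX]
    simp_rw [h1]
    rw [lintegral_finsetSum _ fun _ _ => .of_discrete, ← hμ1]
    refine Finset.sum_congr rfl fun y hy => ?_
    rw [lintegral_const_mul _ .of_discrete, lintegral_const_mul _ .of_discrete,
      lintegral_allKept, mul_left_comm, hb,
      weight_mul_pow anc g hβ hθ1 a μ y (k := 0) (by simp), pow_zero, mul_one, mul_comm]
    by_cases h : g a y = 0
    · simp [hμ y hy h]
    · exact ENNReal.div_mul_cancel h (green_ne_top hX hT a y)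
  have hhit : ∀ s w, Z s w ≠ 0 → ∃ n, X n w ∈ survivors anc F s := by
    intro s w h
    obtain ⟨y, hy, hne⟩ := Finset.exists_ne_zero_of_sum_ne_zero h
    have hocc : occupation X y w ≠ 0 := fun h0 => hne (by rw [h0]; simp)
    have hkept : allKept (anc y) s ≠ 0 := fun h0 => hne (by rw [h0]; simp)
    have hk : ∀ c ∈ anc y, s c = true := by
      by_contra h0
      exact hkept (if_neg h0)
    obtain ⟨n, hn⟩ := not_forall.1 (mt ENNReal.tsum_eq_zero.2 hocc)
    refine ⟨n, ?_⟩
    have hXn : X n w = y := Set.mem_of_indicator_ne_zero (s := {w | X n w = y}) hn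
    rw [hXn]
    exact mem_survivors.2 ⟨hy, hk⟩
  -- A linearised Cauchy–Schwarz inequality: integrate 2tZ ≤ t²Z² + 1 on the event of a hit, outside
  -- which Z vanishes. The optimal choice is t = 1/J.
  have hbound : ∀ t : ℝ≥0∞, 2 * t ≤ t ^ 2 * J + M := by
    intro t
    have hpt : ∀ s w, 2 * t * Z s w ≤ t ^ 2 * Z s w ^ 2 +
        {w | ∃ n, X n w ∈ survivors anc F s}.indicator 1 w := by
      intro s w
      by_cases h : Z s w = 0
      · simp [h]
      · rw [Set.indicator_of_mem (s := {w | ∃ n, X n w ∈ survivors anc F s}) (hhit s w h)]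
        have := two_mul_mul_le_sq_add_sq (t * Z s w) 1
        rwa [mul_one, one_pow, mul_pow, ← mul_assoc] at this
    calc 2 * t = ∫⁻ s, ∫⁻ w, 2 * t * Z s w ∂P a ∂Measure.pi (fun _ => β) := by
          simp_rw [lintegral_const_mul _ (hZm _)]
          rw [lintegral_const_mul _ .of_discrete, hmean, mul_one]
      _ ≤ ∫⁻ s, ∫⁻ w, (t ^ 2 * Z s w ^ 2 +
            {w | ∃ n, X n w ∈ survivors anc F s}.indicator 1 w) ∂P a ∂Measure.pi (fun _ => β) :=
          lintegral_mono fun s => lintegral_mono fun w => hpt s w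
      _ = t ^ 2 * (∫⁻ s, ∫⁻ w, Z s w ^ 2 ∂P a ∂Measure.pi (fun _ => β)) + M := by
          simp_rw [lintegral_add_left (((hZm _).pow_const 2).const_mul _),
            lintegral_const_mul _ ((hZm _).pow_const 2),
            lintegral_indicator_one (measurableSet_hit hX _)]
          rw [lintegral_add_left .of_discrete, lintegral_const_mul _ .of_discrete]
          rfl
      _ ≤ _ := by gcongr
  have hM1 : M ≤ 1 := by
    calc M ≤ ∫⁻ _, 1 ∂Measure.pi (fun _ => β) := lintegral_mono fun s => prob_le_one
      _ = 1 := by simp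
  rcases eq_or_ne J ∞ with hJt | hJt
  · simp [hJt]
  -- If J were 0, then t = 1 would give 2 ≤ M ≤ 1.
  rcases eq_or_ne J 0 with hJ0 | hJ0
  · have := (hbound 1).trans (add_le_add le_rfl hM1)
    rw [hJ0] at this
    norm_num at this
  · have h := hbound J⁻¹
    rw [sq, mul_assoc, ENNReal.inv_mul_cancel hJ0 hJt, mul_one, two_mul] at h
    exact (ENNReal.add_le_add_iff_left (ENNReal.inv_ne_top.2 hJ0)).1 h

/-- The distribution of the first point of the percolation that is visited. -/
noncomputable def hitDist (P : (Fin d → ℤ) → Measure A) (X : ℕ → A → (Fin d → ℤ))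
    (a x : Fin d → ℤ) : ℝ≥0∞ :=
  ∫⁻ s, ∫⁻ w, hitAt X (survivors anc F s : Set (Fin d → ℤ)) x w ∂P a ∂Measure.pi (fun _ => β)

lemma sum_hitAt_survivors (s : κ → Bool) (w : A) :
    ∑ x ∈ F, hitAt X (survivors anc F s : Set (Fin d → ℤ)) x w =
      {w | ∃ n, X n w ∈ survivors anc F s}.indicator 1 w := by
  classical
  rw [← Finset.sum_subset (survivors_subset anc F s), sum_hitAt,
    Set.indicator_apply]
  · rfl
  · intro x _ hx
    exact hitAt_of_notMem (by simpa using hx) w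

lemma sum_hitDist (hX : IsMarkovChain P X) (a : Fin d → ℤ) :
    ∑ x ∈ F, hitDist β anc F P X a x =
      ∫⁻ s, hitProb P X a (survivors anc F s) ∂Measure.pi (fun _ => β) := by
  unfold hitDist hitProb
  rw [← lintegral_finsetSum _ fun _ _ => .of_discrete]
  refine lintegral_congr fun s => ?_
  rw [← lintegral_finsetSum _ fun x _ => measurable_hitAt hX _ x]
  simp_rw [sum_hitAt_survivors]
  exact lintegral_indicator_one (measurableSet_hit hX _)

/-! ### Energy of the hitting distribution, by exploration in a planar order -/

variable {γ : Type*} [LinearOrder γ] (r : (Fin d → ℤ) → γ)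

/-- The ancestors of the points of `F` up to the point `x`. -/
def explored (x : Fin d → ℤ) : Finset κ :=
  {w ∈ F | r w ≤ r x}.biUnion anc

lemma explored_mono {x y : Fin d → ℤ} (h : r x ≤ r y) :
    explored anc F r x ⊆ explored anc F r y :=
  Finset.biUnion_subset_biUnion_of_subset_left _ fun w hw => by
    rw [Finset.mem_filter] at hw ⊢
    exact ⟨hw.1, hw.2.trans h⟩

/-- The contribution of an ordered pair to the energy of the hitting distribution. -/
lemma pair_energy_le (hX : IsMarkovChain P X)
    (hr : ∀ w x y, r w ≤ r x → r x ≤ r y → anc w ∩ anc y ⊆ anc x)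
    (a : Fin d → ℤ) (hβ : β {true} ≠ 0) (μ : (Fin d → ℤ) → ℝ≥0∞) {x y : Fin d → ℤ} (hx : x ∈ F)
    (hxy : r x ≤ r y) :
    green P X x y / green P X a y * (β {true})⁻¹ ^ (anc x ∩ anc y).card *
        hitDist β anc F P X a x * μ y ≤
      ∫⁻ w, ∫⁻ s, condOn β (explored anc F r x)
          (fun s => hitAt X (survivors anc F s : Set (Fin d → ℤ)) x w) s *
        (weight anc (green P X) (β {true}) a μ y * (occupation X y w * allKept (anc y) s))
        ∂Measure.pi (fun _ => β) ∂P a := by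
  have := hX.isProb a
  set θ := β {true} with hθ
  have hθ1 : θ ≠ ∞ := measure_ne_top _ _
  set g := green P X with hg
  set b := weight anc g θ a μ y with hb
  set T := explored anc F r x with hT
  have hanc : anc x ⊆ T := Finset.subset_biUnion_of_mem anc (Finset.mem_filter.2 ⟨hx, le_rfl⟩)
  -- Planarity: an explored ancestor of y is also an ancestor of some w before x, and x lies between
  -- w and y.
  have hinter : anc y ∩ T = anc x ∩ anc y := by
    ext c
    simp only [Finset.mem_inter]
    constructor
    · rintro ⟨h1, h2⟩
      obtain ⟨w, hw, hc⟩ := Finset.mem_biUnion.1 h2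
      exact ⟨hr w x y (Finset.mem_filter.1 hw).2 hxy (Finset.mem_inter.2 ⟨hc, h1⟩), h1⟩
    · exact fun h => ⟨h.2, hanc h.1⟩
  have hs : ∀ w, ∫⁻ s, condOn β T
      (fun s => hitAt X (survivors anc F s : Set (Fin d → ℤ)) x w) s *
        (b * (occupation X y w * allKept (anc y) s)) ∂Measure.pi (fun _ => β) =
      b * θ ^ (anc y \ T).card * ∫⁻ s, hitAt X (survivors anc F s : Set (Fin d → ℤ)) x w *
        occupation X y w ∂Measure.pi (fun _ => β) := by
    intro w
    have e1 : ∀ s, condOn β T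
        (fun s => hitAt X (survivors anc F s : Set (Fin d → ℤ)) x w) s *
          (b * (occupation X y w * allKept (anc y) s)) = b * occupation X y w *
        (condOn β T (fun s => hitAt X (survivors anc F s : Set (Fin d → ℤ)) x w) s *
          allKept (anc y) s) := fun s => by ring
    simp_rw [e1]
    rw [lintegral_const_mul _ .of_discrete, lintegral_mul_const _ .of_discrete,
      ← lintegral_mul_condOn]
    -- A hit at x forces all ancestors of x to be kept, so the explored ancestors of y impose no
    -- further condition; only the unexplored ones cost a factor.
    have e2 : ∀ s, hitAt X (survivors anc F s : Set (Fin d → ℤ)) x w *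
        condOn β T (allKept (anc y)) s =
        hitAt X (survivors anc F s : Set (Fin d → ℤ)) x w * θ ^ (anc y \ T).card := by
      intro s
      by_cases h : x ∈ survivors anc F s
      · rw [condOn_allKept, hinter]
        have : allKept (anc x ∩ anc y) s = 1 :=
          if_pos fun c hc => (mem_survivors.1 h).2 c (Finset.mem_inter.1 hc).1
        rw [this, one_mul]
      · rw [hitAt_of_notMem (by simpa using h), zero_mul, zero_mul]
    simp_rw [e2]
    rw [lintegral_mul_const _ .of_discrete]
    ring
  simp_rw [hs]
  have hm : ∀ s, Measurable fun w =>
      hitAt X (survivors anc F s : Set (Fin d → ℤ)) x w * occupation X y w :=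
    fun s => (measurable_hitAt hX _ x).mul (measurable_occupation hX y)
  have hm' : Measurable fun w => ∫⁻ s, hitAt X (survivors anc F s : Set (Fin d → ℤ)) x w *
      occupation X y w ∂Measure.pi (fun _ => β) := by
    simp_rw [lintegral_fintype]
    exact Finset.measurable_sum _ fun s _ => (hm s).mul_const _
  rw [lintegral_const_mul _ hm', lintegral_pi_swap β (P a) hm]
  have hcard : b * θ ^ (anc y \ T).card = μ y / g a y * θ⁻¹ ^ (anc x ∩ anc y).card := by
    rw [hb, weight_mul_pow anc g hβ hθ1 a μ y]
    rw [← hinter, Finset.card_sdiff_add_card_inter]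
  rw [hcard]
  calc _ = μ y / g a y * θ⁻¹ ^ (anc x ∩ anc y).card * (hitDist β anc F P X a x * g x y) := by
        rw [div_eq_mul_inv, div_eq_mul_inv]
        ring
    _ ≤ _ := by
        refine mul_le_mul_right ?_ _
        unfold hitDist
        rw [← lintegral_mul_const _ .of_discrete]
        exact lintegral_mono fun s => lintegral_hitAt_mul_green_le hX a _ x y

open Classical in
/-- The contribution of the ordered pairs to the energy of the hitting distribution. -/
lemma ordered_energy_le (hX : IsMarkovChain P X) (hT : IsTransient P X)
    (hr : ∀ w x y, r w ≤ r x → r x ≤ r y → anc w ∩ anc y ⊆ anc x)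
    (a : Fin d → ℤ) (hβ : β {true} ≠ 0) :
    8 * ∑ x ∈ F, ∑ y ∈ F, (if r x ≤ r y then
        green P X x y / green P X a y * (β {true})⁻¹ ^ (anc x ∩ anc y).card *
          hitDist β anc F P X a x * hitDist β anc F P X a y else 0) ≤
      64 * (∑ x ∈ F, hitDist β anc F P X a x) +
        2 * treeEnergy anc F (green P X) (β {true}) a (hitDist β anc F P X a) := by
  have := hX.isProb a
  set ν := hitDist β anc F P X a with hν
  have hν0 : ∀ y ∈ F, green P X a y = 0 → ν y = 0 := by
    intro y _ h
    refine le_antisymm ?_ zero_le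
    calc ν y ≤ ∫⁻ _, 0 ∂Measure.pi (fun _ : κ => β) := lintegral_mono fun s =>
          (lintegral_hitAt_le_green hX a _ y).trans h.le
      _ = 0 := by simp
  have hZ2 := lintegral_weightedOccupation_sq_le β anc F hX hT a hβ ν hν0
  set b := weight anc (green P X) (β {true}) a ν with hb
  set Z := weightedOccupation anc F X b with hZ
  have hZm : ∀ s, Measurable (Z s) := fun s => measurable_weightedOccupation anc F hX b s
  set h : (Fin d → ℤ) → A → (κ → Bool) → ℝ≥0∞ := fun x w s =>
    hitAt X (survivors anc F s : Set (Fin d → ℤ)) x w with hh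
  have hhm : ∀ x s, Measurable fun w => h x w s := fun x s => measurable_hitAt hX _ x
  set S : (κ → Bool) → A → ℝ≥0∞ := fun s w =>
    ∑ x ∈ F, condOn β (explored anc F r x) (h x w) s with hS
  have hcm : ∀ x s, Measurable fun w => condOn β (explored anc F r x) (h x w) s := by
    intro x s
    unfold condOn lmarginal
    simp_rw [lintegral_fintype]
    exact Finset.measurable_sum _ fun s _ => (hhm x _).mul_const _
  have hSm : ∀ s, Measurable (S s) := fun s => Finset.measurable_sum _ fun x _ => hcm x s
  -- The explored sets are nested, so the dual Doob inequality applies for each path. The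
  -- unconditioned sum is the indicator of a hit and equals its own square.
  have hS2 : ∫⁻ w, ∫⁻ s, S s w ^ 2 ∂Measure.pi (fun _ => β) ∂P a ≤ 4 * ∑ x ∈ F, ν x := by
    calc _ ≤ ∫⁻ w, 4 * ∫⁻ s, (∑ x ∈ F, h x w s) ^ 2 ∂Measure.pi (fun _ => β) ∂P a := by
          refine lintegral_mono fun w => ?_
          refine lintegral_sum_condOn_sq_le β F _ (fun x y => ?_) (fun x => h x w) fun x s => ?_
          · exact (le_total (r x) (r y)).imp (explored_mono anc F r) (explored_mono anc F r)
          · by_cases hx : x ∈ F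
            · calc h x w s ≤ ∑ x ∈ F, h x w s :=
                    Finset.single_le_sum (f := fun x => h x w s) (fun _ _ => zero_le) hx
                _ ≤ 1 := by
                  rw [sum_hitAt_survivors]
                  exact Set.indicator_le_self' (fun _ _ => zero_le) w
            · rw [hh]
              dsimp only
              rw [hitAt_of_notMem]
              · exact zero_le
              · exact fun h => hx (mem_survivors.1 h).1
      _ = 4 * ∑ x ∈ F, ν x := by
          have hm1 : ∀ s, Measurable fun w => (∑ x ∈ F, h x w s) ^ 2 := fun s =>
            (Finset.measurable_sum _ fun x _ => hhm x s).pow_const 2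
          rw [lintegral_const_mul, lintegral_pi_swap β (P a) hm1, sum_hitDist β anc F hX]
          · congr 1
            refine lintegral_congr fun s => ?_
            rw [hitProb, ← lintegral_indicator_one (measurableSet_hit hX _)]
            refine lintegral_congr fun w => ?_
            rw [sum_hitAt_survivors]
            by_cases hw : w ∈ {w | ∃ n, X n w ∈ survivors anc F s} <;> simp [hw]
          · simp_rw [lintegral_fintype]
            exact Finset.measurable_sum _ fun s _ => (hm1 s).mul_const _
  have hmain : ∑ x ∈ F, ∑ y ∈ F, (if r x ≤ r y then
      green P X x y / green P X a y * (β {true})⁻¹ ^ (anc x ∩ anc y).card * ν x * ν y else 0) ≤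
      ∫⁻ w, ∫⁻ s, S s w * Z s w ∂Measure.pi (fun _ => β) ∂P a := by
    have e : ∫⁻ w, ∫⁻ s, S s w * Z s w ∂Measure.pi (fun _ => β) ∂P a = ∑ x ∈ F, ∑ y ∈ F,
        ∫⁻ w, ∫⁻ s, condOn β (explored anc F r x) (h x w) s *
          (b y * (occupation X y w * allKept (anc y) s)) ∂Measure.pi (fun _ => β) ∂P a := by
      have hm2 : ∀ x y s, Measurable fun w => condOn β (explored anc F r x) (h x w) s *
          (b y * (occupation X y w * allKept (anc y) s)) := fun x y s =>
        (hcm x s).mul (((measurable_occupation hX y).mul_const _).const_mul _)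
      simp_rw [hS, hZ, weightedOccupation, Finset.sum_mul_sum]
      rw [lintegral_pi_swap β (P a) fun s => Finset.measurable_sum F fun x _ =>
        Finset.measurable_sum F fun y _ => hm2 x y s]
      simp_rw [lintegral_pi_swap β (P a) (hm2 _ _)]
      simp_rw [lintegral_finsetSum F fun x _ => Finset.measurable_sum F fun y _ => hm2 x y _]
      rw [lintegral_finsetSum _ fun _ _ => .of_discrete]
      refine Finset.sum_congr rfl fun x _ => ?_
      simp_rw [lintegral_finsetSum F fun y _ => hm2 x y _]
      exact lintegral_finsetSum _ fun _ _ => .of_discrete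
    rw [e]
    refine Finset.sum_le_sum fun x hx => Finset.sum_le_sum fun y _ => ?_
    split_ifs with hxy
    · exact pair_energy_le β anc F r hX hr a hβ ν hx hxy
    · exact zero_le
  have hm3 : ∀ s, Measurable fun w => S s w ^ 2 := fun s => (hSm s).pow_const 2
  have hSZ : ∀ s, Measurable fun w => S s w * Z s w := fun s => (hSm s).mul (hZm s)
  rw [lintegral_pi_swap β (P a) hm3] at hS2
  rw [lintegral_pi_swap β (P a) hSZ] at hmain
  -- The weights leave only 2J from Z² on each half of the pairs, so that 4J in total can be
  -- absorbed into 8J.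
  have hpt : ∀ s w, 8 * (S s w * Z s w) ≤ 16 * S s w ^ 2 + Z s w ^ 2 := by
    intro s w
    have := two_mul_mul_le_sq_add_sq (4 * S s w) (Z s w)
    rw [mul_pow, mul_assoc, ← mul_assoc] at this
    norm_num at this
    exact this
  calc _ ≤ 8 * ∫⁻ s, ∫⁻ w, S s w * Z s w ∂P a ∂Measure.pi (fun _ => β) :=
        mul_le_mul_right hmain 8
    _ = ∫⁻ s, ∫⁻ w, 8 * (S s w * Z s w) ∂P a ∂Measure.pi (fun _ => β) := by
        simp_rw [lintegral_const_mul _ (hSZ _)]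
        rw [lintegral_const_mul _ .of_discrete]
    _ ≤ ∫⁻ s, ∫⁻ w, (16 * S s w ^ 2 + Z s w ^ 2) ∂P a ∂Measure.pi (fun _ => β) :=
        lintegral_mono fun s => lintegral_mono fun w => hpt s w
    _ = 16 * (∫⁻ s, ∫⁻ w, S s w ^ 2 ∂P a ∂Measure.pi (fun _ => β)) +
          ∫⁻ s, ∫⁻ w, Z s w ^ 2 ∂P a ∂Measure.pi (fun _ => β) := by
        simp_rw [lintegral_add_left ((hm3 _).const_mul 16), lintegral_const_mul _ (hm3 _)]
        rw [lintegral_add_left .of_discrete, lintegral_const_mul _ .of_discrete]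
    _ ≤ 16 * (4 * ∑ x ∈ F, ν x) + 2 * treeEnergy anc F (green P X) (β {true}) a ν := by
        gcongr
    _ = _ := by
        rw [← mul_assoc]
        norm_num

/-- The energy of the hitting distribution is bounded by its total mass. -/
lemma treeEnergy_hitDist_le (hX : IsMarkovChain P X) (hT : IsTransient P X)
    (hr : ∀ w x y, r w ≤ r x → r x ≤ r y → anc w ∩ anc y ⊆ anc x)
    (a : Fin d → ℤ) (hβ : β {true} ≠ 0) :
    treeEnergy anc F (green P X) (β {true}) a (hitDist β anc F P X a) ≤
      32 * ∑ x ∈ F, hitDist β anc F P X a x := by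
  classical
  have := hX.isProb a
  have h1 := ordered_energy_le β anc F r hX hT hr a hβ
  -- The energy kernel is not symmetric, so the opposite pairs need a second exploration, in the
  -- reversed order. Planarity is preserved under reversal.
  have h2 := ordered_energy_le β anc F (fun x => OrderDual.toDual (r x)) hX hT
    (fun w x y h h' => by
      rw [Finset.inter_comm]
      exact hr y x w h' h) a hβ
  simp only [OrderDual.toDual_le_toDual] at h2
  set ν := hitDist β anc F P X a with hν
  set J := treeEnergy anc F (green P X) (β {true}) a ν with hJ
  set M := ∑ x ∈ F, ν x with hM
  have hνtop : ∀ y, ν y ≠ ∞ := fun y => by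
    refine ne_top_of_le_ne_top (green_ne_top hX hT a y) ?_
    calc ν y ≤ ∫⁻ _, green P X a y ∂Measure.pi (fun _ : κ => β) := lintegral_mono fun s =>
          lintegral_hitAt_le_green hX a _ y
      _ = _ := by simp
  -- Finiteness, needed to absorb J, rests on transience. Points with zero Green function from `a`
  -- carry no mass of ν.
  have hJtop : J ≠ ∞ := by
    refine ENNReal.sum_ne_top.2 fun x _ => ENNReal.sum_ne_top.2 fun y _ => ?_
    by_cases h0 : green P X a y = 0
    · have : ν y = 0 := by
        refine le_antisymm ?_ zero_le
        calc ν y ≤ ∫⁻ _, 0 ∂Measure.pi (fun _ : κ => β) := lintegral_mono fun s =>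
              (lintegral_hitAt_le_green hX a _ y).trans h0.le
          _ = 0 := by simp
      simp [this]
    · refine ENNReal.mul_ne_top (ENNReal.mul_ne_top (ENNReal.mul_ne_top ?_ ?_) (hνtop x)) (hνtop y)
      · exact ENNReal.div_ne_top (green_ne_top hX hT x y) h0
      · exact ENNReal.pow_ne_top (ENNReal.inv_ne_top.2 hβ)
  have hsplit : J ≤ (∑ x ∈ F, ∑ y ∈ F, (if r x ≤ r y then green P X x y / green P X a y *
        (β {true})⁻¹ ^ (anc x ∩ anc y).card * ν x * ν y else 0)) +
      ∑ x ∈ F, ∑ y ∈ F, (if r y ≤ r x then green P X x y / green P X a y *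
        (β {true})⁻¹ ^ (anc x ∩ anc y).card * ν x * ν y else 0) := by
    simp_rw [← Finset.sum_add_distrib]
    refine Finset.sum_le_sum fun x _ => Finset.sum_le_sum fun y _ => ?_
    rcases le_total (r x) (r y) with h | h <;> simp [h]
  have h3 : 8 * J ≤ (64 * M + 2 * J) + (64 * M + 2 * J) := by
    refine (mul_le_mul_right hsplit 8).trans ?_
    rw [mul_add]
    exact add_le_add h1 h2
  have h4 : 4 * J + 4 * J ≤ 4 * J + 4 * (32 * M) := by
    calc 4 * J + 4 * J = 8 * J := by ring
      _ ≤ _ := h3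
      _ = _ := by ring
  have h5 := (ENNReal.add_le_add_iff_left (by finiteness)).1 h4
  exact (ENNReal.mul_le_mul_iff_right (by norm_num) (by norm_num)).1 h5

end HittingPercolation

/-! ### Dyadic cubes, shells and the tree of ancestors -/

section Geometry

variable {d : ℕ}

lemma toPoint_mem_bigCube {x : Fin d → ℤ} {k : ℕ} :
    toPoint x ∈ bigCube d k ↔ ∀ i, -2 ^ k ≤ x i ∧ x i < 2 ^ k := by
  refine forall_congr' fun i => and_congr ?_ ?_
  · rw [toPoint, ← Int.cast_le (R := ℝ)]
    push_cast
    rfl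
  · rw [toPoint, ← Int.cast_lt (R := ℝ)]
    push_cast
    rfl

lemma bigCube_mono {j k : ℕ} (h : j ≤ k) : bigCube d j ⊆ bigCube d k := by
  intro x hx i
  have h2 : (2 : ℝ) ^ j ≤ 2 ^ k := pow_le_pow_right₀ (by norm_num) h
  exact ⟨(neg_le_neg h2).trans (hx i).1, (hx i).2.trans_le h2⟩

lemma mem_shell_iff {x : Fin d → ℝ} {k : ℕ} :
    x ∈ shell d k ↔ x ∈ bigCube d k ∧ ∀ j < k, x ∉ bigCube d j := by
  cases k with
  | zero => simp [shell]
  | succ k =>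
    refine and_congr_right fun _ => ⟨fun h j hj hx => h (bigCube_mono (by omega) hx), fun h => ?_⟩
    exact h k (by omega)

lemma exists_mem_bigCube (x : Fin d → ℤ) : ∃ k, toPoint x ∈ bigCube d k := by
  refine ⟨∑ i, (x i).natAbs, toPoint_mem_bigCube.2 fun i => ?_⟩
  have h1 : (x i).natAbs ≤ ∑ i, (x i).natAbs :=
    Finset.single_le_sum (f := fun i => (x i).natAbs) (fun _ _ => Nat.zero_le _)
      (Finset.mem_univ i)
  have h2 : ((∑ i, (x i).natAbs : ℕ) : ℤ) < 2 ^ (∑ i, (x i).natAbs) := by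
    exact_mod_cast Nat.lt_two_pow_self
  constructor <;> omega

lemma mem_shell_unique {x : Fin d → ℝ} {j k : ℕ} (hj : x ∈ shell d j) (hk : x ∈ shell d k) :
    j = k := by
  rw [mem_shell_iff] at hj hk
  by_contra h
  rcases lt_or_gt_of_ne h with h | h
  · exact hk.2 j h hj.1
  · exact hj.2 k h hk.1

lemma toPoint_mem_shell_shellIndex (x : Fin d → ℤ) : toPoint x ∈ shell d (shellIndex x) := by
  classical
  refine Nat.sInf_mem (s := {k : ℕ | toPoint x ∈ shell d k}) ?_
  exact ⟨Nat.find (exists_mem_bigCube x), mem_shell_iff.2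
    ⟨Nat.find_spec (exists_mem_bigCube x), fun j hj => Nat.find_min (exists_mem_bigCube x) hj⟩⟩

lemma toPoint_mem_shell {x : Fin d → ℤ} {k : ℕ} : toPoint x ∈ shell d k ↔ shellIndex x = k :=
  ⟨fun h => mem_shell_unique (toPoint_mem_shell_shellIndex x) h,
    fun h => h ▸ toPoint_mem_shell_shellIndex x⟩

lemma toPoint_mem_bigCube_shellIndex (x : Fin d → ℤ) :
    toPoint x ∈ bigCube d (shellIndex x) :=
  (mem_shell_iff.1 (toPoint_mem_shell_shellIndex x)).1

lemma sameShell_iff {x y : Fin d → ℤ} : SameShell x y ↔ shellIndex x = shellIndex y := by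
  simp only [SameShell, toPoint_mem_shell]
  exact ⟨fun ⟨k, h1, h2⟩ => h1.trans h2.symm, fun h => ⟨_, rfl, h.symm⟩⟩

/-- The dyadic cube of level `n` that contains `x`. -/
def cubeAt (x : Fin d → ℤ) (n : ℕ) : DyadicCube d := ⟨n, fun i => x i / 2 ^ n⟩

/-- Integer division by `2 ^ n` rounds down also for negative coordinates, so it yields the corner.
-/
lemma toPoint_mem_toSet {x : Fin d → ℤ} {Q : DyadicCube d} {n : ℕ} (hQ : Q.level = n) :
    toPoint x ∈ Q.toSet ↔ Q = cubeAt x n := by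
  have h2 : (0 : ℤ) < 2 ^ n := by positivity
  have hmem : toPoint x ∈ Q.toSet ↔ ∀ i, Q.corner i = x i / 2 ^ n := by
    refine forall_congr' fun i => ?_
    have e1 : (Q.corner i : ℝ) * (2 : ℝ) ^ Q.level ≤ toPoint x i ↔ Q.corner i * 2 ^ n ≤ x i := by
      rw [hQ, zpow_natCast, toPoint, ← Int.cast_le (R := ℝ)]
      push_cast
      rfl
    have e2 : toPoint x i < ((Q.corner i : ℝ) + 1) * (2 : ℝ) ^ Q.level ↔
        x i < (Q.corner i + 1) * 2 ^ n := by
      rw [hQ, zpow_natCast, toPoint, ← Int.cast_lt (R := ℝ)]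
      push_cast
      rfl
    rw [e1, e2, ← Int.le_ediv_iff_mul_le h2, ← Int.ediv_lt_iff_lt_mul h2]
    omega
  rw [hmem, DyadicCube.ext_iff]
  simp only [cubeAt, hQ, true_and, funext_iff]

lemma toPoint_mem_cubeAt (x : Fin d → ℤ) (n : ℕ) : toPoint x ∈ (cubeAt x n).toSet :=
  (toPoint_mem_toSet rfl).2 rfl

lemma cubeAt_toSet_subset {x : Fin d → ℤ} {n k : ℕ} (hn : n ≤ k)
    (hx : toPoint x ∈ bigCube d k) : (cubeAt x n).toSet ⊆ bigCube d k := by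
  intro y hy i
  have h2 : (0 : ℤ) < 2 ^ n := by positivity
  have hx := toPoint_mem_bigCube.1 hx i
  have hk : (2 : ℤ) ^ k = 2 ^ (k - n) * 2 ^ n := by rw [← pow_add, Nat.sub_add_cancel hn]
  have h3 : -2 ^ (k - n) ≤ x i / 2 ^ n := by
    rw [Int.le_ediv_iff_mul_le h2, neg_mul, ← hk]
    exact hx.1
  have h4 : x i / 2 ^ n + 1 ≤ 2 ^ (k - n) := by
    rw [Int.add_one_le_iff, Int.ediv_lt_iff_lt_mul h2, ← hk]
    exact hx.2
  have hkR : (2 : ℝ) ^ k = 2 ^ (k - n) * 2 ^ n := by rw [← pow_add, Nat.sub_add_cancel hn]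
  have hy := hy i
  simp only [cubeAt, zpow_natCast] at hy
  have h3R : -(2 : ℝ) ^ (k - n) ≤ ((x i / 2 ^ n : ℤ) : ℝ) := by exact_mod_cast h3
  have h4R : ((x i / 2 ^ n : ℤ) : ℝ) + 1 ≤ 2 ^ (k - n) := by exact_mod_cast h4
  have hpos : (0 : ℝ) ≤ 2 ^ n := by positivity
  constructor
  · calc -(2 : ℝ) ^ k = -2 ^ (k - n) * 2 ^ n := by rw [hkR]; ring
      _ ≤ ((x i / 2 ^ n : ℤ) : ℝ) * 2 ^ n := mul_le_mul_of_nonneg_right h3R hpos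
      _ ≤ y i := hy.1
  · calc y i < (((x i / 2 ^ n : ℤ) : ℝ) + 1) * 2 ^ n := hy.2
      _ ≤ 2 ^ (k - n) * 2 ^ n := mul_le_mul_of_nonneg_right h4R hpos
      _ = 2 ^ k := hkR.symm

lemma cubeAt_zero_subset (x : Fin d → ℤ) (n : ℕ) :
    (cubeAt x 0).toSet ⊆ (cubeAt x n).toSet := by
  intro y hy i
  have h2 : (0 : ℤ) < 2 ^ n := by positivity
  have hy := hy i
  simp only [cubeAt, zpow_natCast, pow_zero, mul_one, Int.ediv_one] at hy
  simp only [cubeAt, zpow_natCast]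
  have h3 : x i / 2 ^ n * 2 ^ n ≤ x i := Int.ediv_mul_le _ h2.ne'
  have h4 : x i + 1 ≤ (x i / 2 ^ n + 1) * 2 ^ n := Int.lt_ediv_add_one_mul_self _ h2
  have h3R : ((x i / 2 ^ n : ℤ) : ℝ) * 2 ^ n ≤ x i := by exact_mod_cast h3
  have h4R : (x i : ℝ) + 1 ≤ (((x i / 2 ^ n : ℤ) : ℝ) + 1) * 2 ^ n := by exact_mod_cast h4
  exact ⟨h3R.trans hy.1, hy.2.trans_le h4R⟩

/-- Such a cube has the sidelength of `V_k` but is misaligned with it: the lower corner and the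
centre would force an integer strictly between −1 and 0. A coordinate is needed, hence `1 ≤ d`. -/
lemma level_ne_of_subset_bigCube (hd : 1 ≤ d) {k : ℕ} {Q : DyadicCube d}
    (hQ : Q.toSet ⊆ bigCube d k) : Q.level ≠ (k : ℤ) + 1 := by
  intro h
  have hlev : (2 : ℝ) ^ Q.level = 2 * 2 ^ k := by
    rw [h, zpow_add₀ (by norm_num), zpow_natCast, zpow_one, mul_comm]
  have hpos : (0 : ℝ) < 2 ^ k := by positivity
  have h1 : (fun i => (Q.corner i : ℝ) * 2 ^ Q.level) ∈ Q.toSet := fun i => by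
    rw [hlev]
    constructor <;> dsimp only <;> nlinarith
  have h2 : (fun i => ((Q.corner i : ℝ) + 2⁻¹) * 2 ^ Q.level) ∈ Q.toSet := fun i => by
    rw [hlev]
    constructor <;> dsimp only <;> nlinarith
  have h3 := (hQ h1 ⟨0, hd⟩).1
  have h4 := (hQ h2 ⟨0, hd⟩).2
  simp only [hlev] at h3 h4
  have h5 : (-1 : ℝ) < Q.corner ⟨0, hd⟩ := by
    by_contra h
    nlinarith
  have h6 : (Q.corner ⟨0, hd⟩ : ℝ) < 0 := by
    by_contra h
    nlinarith
  have h5 : -1 < Q.corner ⟨0, hd⟩ := by exact_mod_cast h5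
  have h6 : Q.corner ⟨0, hd⟩ < 0 := by exact_mod_cast h6
  omega

/-- The cube of level `n` around `x` among the cubes in `V_k`, where `S_k` is the shell of `x`. -/
noncomputable def ancestor (x : Fin d → ℤ) (n : Fin (shellIndex x + 1)) : Σ k : ℕ, CubeIn d k :=
  ⟨shellIndex x, cubeAt x n,
    cubeAt_toSet_subset (Nat.lt_succ_iff.1 n.2) (toPoint_mem_bigCube_shellIndex x)⟩

open Classical in
/-- The cubes in `V_k` of levels `0, …, k` that contain `x`, where `S_k` is the shell of `x`. -/
noncomputable def ancestors (x : Fin d → ℤ) : Finset (Σ k : ℕ, CubeIn d k) :=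
  Finset.univ.image (ancestor x)

lemma mem_ancestors {x : Fin d → ℤ} {c : Σ k : ℕ, CubeIn d k} :
    c ∈ ancestors x ↔ c.1 = shellIndex x ∧ ∃ n ≤ shellIndex x, c.2.1 = cubeAt x n := by
  classical
  simp only [ancestors, Finset.mem_image, Finset.mem_univ, true_and]
  constructor
  · rintro ⟨n, rfl⟩
    exact ⟨rfl, n, Nat.lt_succ_iff.1 n.2, rfl⟩
  · obtain ⟨k, Q, hQ⟩ := c
    rintro ⟨rfl, n, hn, rfl⟩
    exact ⟨⟨n, Nat.lt_succ_iff.2 hn⟩, rfl⟩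

lemma toPoint_mem_percolation (hd : 1 ≤ d) {q : ℝ} {u : (k : ℕ) → CubeIn d k → ℝ}
    {x : Fin d → ℤ} :
    toPoint x ∈ percolation q u ↔ ∀ c ∈ ancestors x, u c.1 c.2 ∈ Set.Ioo 0 q := by
  have hkeep : ∀ k (Q : CubeIn d k), keep q (u k) Q = 1 ↔ u k Q ∈ Set.Ioo 0 q := by
    intro k Q
    unfold keep
    by_cases h : u k Q ∈ Set.Ioo 0 q
    · simp only [Set.indicator_of_mem h, h, Pi.one_apply]
    · simp [h]
  simp only [percolation, Set.mem_iUnion, Set.mem_inter_iff]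
  constructor
  · rintro ⟨k, ⟨Q, ⟨hlev, hsub, hQ⟩, hxQ⟩, hk⟩ c hc
    obtain rfl := toPoint_mem_shell.1 hk
    obtain ⟨hc1, n, hn, hcn⟩ := mem_ancestors.1 hc
    obtain ⟨k, Q', hQ'⟩ := c
    dsimp only at hc1 hcn
    subst hc1 hcn
    have hQ0 : Q = cubeAt x 0 := (toPoint_mem_toSet (by simpa using hlev)).1 hxQ
    refine (hkeep _ _).1 (hQ ⟨cubeAt x n, hQ'⟩ ?_ ?_ ?_)
    · rw [hQ0]
      exact cubeAt_zero_subset x n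
    · simp [cubeAt]
    · simp only [cubeAt]
      omega
  · intro h
    refine ⟨shellIndex x, ⟨cubeAt x 0, ⟨by simp [cubeAt], ?_, ?_⟩, toPoint_mem_cubeAt x 0⟩,
      toPoint_mem_shell_shellIndex x⟩
    · exact cubeAt_toSet_subset (Nat.zero_le _) (toPoint_mem_bigCube_shellIndex x)
    · rintro ⟨Q', hQ'⟩ hsub h0 h1
      dsimp only at hsub h0 h1
      rw [sub_self] at h0
      obtain ⟨n, hn⟩ := Int.eq_ofNat_of_zero_le h0
      have hne := level_ne_of_subset_bigCube hd hQ'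
      have hQn : Q' = cubeAt x n := (toPoint_mem_toSet hn).1 (hsub (toPoint_mem_cubeAt x 0))
      exact (hkeep _ _).2 (h ⟨shellIndex x, Q', hQ'⟩ (mem_ancestors.2 ⟨rfl, n, by omega, hQn⟩))

lemma cubeAt_eq_of_le {x y : Fin d → ℤ} {m n : ℕ} (hmn : m ≤ n) (h : cubeAt x m = cubeAt y m) :
    cubeAt x n = cubeAt y n := by
  have h1 : ∀ i, x i / 2 ^ m = y i / 2 ^ m := fun i => congrFun (congrArg DyadicCube.corner h) i
  have h2 : ∀ z : ℤ, z / 2 ^ n = z / 2 ^ m / 2 ^ (n - m) := fun z => by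
    rw [Int.ediv_ediv_of_nonneg (by positivity), ← pow_add, Nat.add_sub_cancel' hmn]
  simp only [cubeAt, DyadicCube.mk.injEq, true_and]
  funext i
  rw [h2, h2 (y i), h1]

open Classical in
-- Common cubes persist at higher levels, so the common ancestors occupy the levels from the minimum
-- up to k. The default value k + 1 of the minimum makes the count 0.
lemma card_ancestors_inter {x y : Fin d → ℤ} (h : SameShell x y) :
    (ancestors x ∩ ancestors y).card = commonDepth x y := by
  rw [sameShell_iff] at h
  set k := shellIndex x with hk
  set N := {n : ℕ | n = k + 1 ∨
    ∃ Q : DyadicCube d, Q.level = n ∧ toPoint x ∈ Q.toSet ∧ toPoint y ∈ Q.toSet} with hN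
  have hNiff : ∀ n, n ∈ N ↔ n = k + 1 ∨ cubeAt x n = cubeAt y n := by
    intro n
    refine or_congr_right ⟨?_, fun h => ?_⟩
    · rintro ⟨Q, hQ, h1, h2⟩
      exact ((toPoint_mem_toSet hQ).1 h1).symm.trans ((toPoint_mem_toSet hQ).1 h2)
    · exact ⟨cubeAt x n, rfl, toPoint_mem_cubeAt x n, h ▸ toPoint_mem_cubeAt y n⟩
  have hinf : ∀ n ≤ k, cubeAt x n = cubeAt y n ↔ sInf N ≤ n := by
    intro n hn
    constructor
    · exact fun h => Nat.sInf_le ((hNiff n).2 (Or.inr h))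
    · intro hle
      have hmem : sInf N ∈ N := Nat.sInf_mem ⟨k + 1, Or.inl rfl⟩
      rcases (hNiff _).1 hmem with h1 | h1
      · omega
      · exact cubeAt_eq_of_le hle h1
  have himage : ancestors x ∩ ancestors y =
      ({n : Fin (k + 1) | sInf N ≤ n} : Finset (Fin (k + 1))).image (ancestor x) := by
    ext c
    simp only [Finset.mem_inter, mem_ancestors, Finset.mem_image, Finset.mem_filter,
      Finset.mem_univ, true_and]
    constructor
    · rintro ⟨⟨h1, n, hn, h2⟩, -, m, -, h3⟩
      have hnm : n = m := by
        have := congrArg DyadicCube.level (h2.symm.trans h3)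
        simpa [cubeAt] using this
      subst hnm
      refine ⟨⟨n, by omega⟩, (hinf n hn).1 (h2.symm.trans h3), ?_⟩
      obtain ⟨l, Q, hQ⟩ := c
      dsimp only at h1 h2
      subst h1 h2
      rfl
    · rintro ⟨n, hn, rfl⟩
      have hnk : n.1 ≤ k := Nat.lt_succ_iff.1 n.2
      exact ⟨⟨rfl, n, hnk, rfl⟩, h, n, h ▸ hnk, (hinf n hnk).2 hn⟩
  have hinj : Function.Injective (ancestor x) := by
    intro m n hmn
    have h1 : cubeAt x m = cubeAt x n := by
      simp only [ancestor, Sigma.mk.injEq, heq_eq_eq, true_and, Subtype.mk.injEq] at hmn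
      exact hmn
    have := congrArg DyadicCube.level h1
    exact Fin.ext (by simpa [cubeAt] using this)
  rw [himage, Finset.card_image_of_injective _ hinj]
  change _ = (k + 1) - sInf N
  rw [← Nat.card_Ico, ← Finset.card_map Fin.valEmbedding]
  congr 1
  ext n
  simp only [Finset.mem_map, Finset.mem_filter, Finset.mem_univ, true_and, Finset.mem_Ico,
    Fin.valEmbedding_apply]
  exact ⟨fun ⟨m, h1, h2⟩ => h2 ▸ ⟨h1, m.2⟩, fun h => ⟨⟨n, h.2⟩, h.1, rfl⟩⟩

/-- An ancestor records its shell index along with the cube, as the weights do; a cube occurring for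
two indices counts as two independent nodes. -/
lemma disjoint_ancestors {x y : Fin d → ℤ} (h : ¬ SameShell x y) :
    Disjoint (ancestors x) (ancestors y) := by
  rw [sameShell_iff] at h
  exact Finset.disjoint_left.2 fun c h1 h2 =>
    h ((mem_ancestors.1 h1).1.symm.trans (mem_ancestors.1 h2).1)

/-- The position of `x` in the order of the tree of cubes. -/
noncomputable def treeKey (x : Fin d → ℤ) : Lex (ℕ → ℕ) :=
  -- Positions 1, …, k + 1 record the cubes of levels k, …, 0, so a common ancestor means a common
  -- prefix. Later positions repeat level 0 by truncated subtraction.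
  toLex fun j => if j = 0 then shellIndex x else
    Encodable.encode (cubeAt x (shellIndex x + 1 - j)).corner

lemma lex_eq_of_between {u v w : Lex (ℕ → ℕ)} (huv : u ≤ v) (hvw : v ≤ w) {N : ℕ}
    (h : ∀ i < N, ofLex u i = ofLex w i) : ∀ i < N, ofLex v i = ofLex u i := by
  have key : ∀ {a b : Lex (ℕ → ℕ)} {i : ℕ}, a ≤ b → (∀ j < i, ofLex a j = ofLex b j) →
      ofLex a i ≤ ofLex b i := by
    intro a b i hab heq
    rcases hab.eq_or_lt with rfl | ⟨k, hk, hlt⟩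
    · exact le_rfl
    · rcases lt_trichotomy i k with h | rfl | h
      · exact (hk i h).le
      · exact hlt.le
      · exact absurd (heq k h) hlt.ne
  intro i
  induction i using Nat.strong_induction_on with
  | _ i ih =>
    intro hi
    have h1 : ofLex u i ≤ ofLex v i := key huv fun j hj => (ih j hj (hj.trans hi)).symm
    have h2 : ofLex v i ≤ ofLex w i := key hvw fun j hj =>
      (ih j hj (hj.trans hi)).trans (h j (hj.trans hi))
    exact le_antisymm (h2.trans (h i hi).ge) h1

open Classical in
-- The descendants of a cube share a prefix of their keys, and keys with a given prefix form an
-- interval of the lexicographic order.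
lemma ancestors_inter_subset {w x y : Fin d → ℤ} (hwx : treeKey w ≤ treeKey x)
    (hxy : treeKey x ≤ treeKey y) : ancestors w ∩ ancestors y ⊆ ancestors x := by
  intro c hc
  obtain ⟨hcw, hcy⟩ := Finset.mem_inter.1 hc
  obtain ⟨h1, n, hn, h2⟩ := mem_ancestors.1 hcw
  obtain ⟨h3, m, hm, h4⟩ := mem_ancestors.1 hcy
  have hnm : n = m := by
    have := congrArg DyadicCube.level (h2.symm.trans h4)
    simpa [cubeAt] using this
  subst hnm
  have hwy : shellIndex w = shellIndex y := h1.symm.trans h3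
  -- The prefix must include position k + 1 − n, where level n is recorded.
  have hagree : ∀ i < shellIndex w + 2 - n, ofLex (treeKey w) i = ofLex (treeKey y) i := by
    intro i hi
    simp only [treeKey, ofLex_toLex]
    split_ifs with h0
    · exact hwy
    · rw [← hwy, cubeAt_eq_of_le (m := n) (by omega) (h2.symm.trans h4)]
  have hx := lex_eq_of_between hwx hxy hagree
  have hx0 : shellIndex x = shellIndex w := by
    have := hx 0 (by omega)
    simpa [treeKey] using this
  have hxn : cubeAt x n = cubeAt w n := by
    have := hx (shellIndex w + 1 - n) (by omega)
    simp only [treeKey, ofLex_toLex, hx0] at this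
    rw [if_neg (by omega), if_neg (by omega)] at this
    have h5 := Encodable.encode_injective this
    rw [show shellIndex w + 1 - (shellIndex w + 1 - n) = n by omega] at h5
    exact DyadicCube.ext rfl h5
  exact mem_ancestors.2 ⟨h1.trans hx0.symm, n, hx0 ▸ hn, h2.trans hxn.symm⟩

end Geometry

/-! ### Capacity and hitting probability -/

section Capacity

variable {d : ℕ} {A : Type*} [MeasurableSpace A]
  {P : (Fin d → ℤ) → Measure A} {X : ℕ → A → (Fin d → ℤ)}

open Classical in
/-- The ancestors of `x`, among the cubes in the finite set `C`. -/
noncomputable def ancestorsIn (C : Finset (Σ k : ℕ, CubeIn d k)) (x : Fin d → ℤ) : Finset C :=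
  (ancestors x).subtype (· ∈ C)

lemma mem_ancestorsIn {C : Finset (Σ k : ℕ, CubeIn d k)} {x : Fin d → ℤ} {c : C} :
    c ∈ ancestorsIn C x ↔ c.1 ∈ ancestors x := by
  classical
  exact Finset.mem_subtype

open Classical in
lemma card_ancestorsIn_inter {C : Finset (Σ k : ℕ, CubeIn d k)} {x : Fin d → ℤ}
    (hx : ancestors x ⊆ C) (y : Fin d → ℤ) :
    (ancestorsIn C x ∩ ancestorsIn C y).card = (ancestors x ∩ ancestors y).card := by
  rw [← Finset.card_map (Function.Embedding.subtype _)]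
  congr 1
  ext c
  simp only [Finset.mem_map, Finset.mem_inter, mem_ancestorsIn, Function.Embedding.coe_subtype]
  exact ⟨fun ⟨e, h1, h2⟩ => h2 ▸ h1, fun h => ⟨⟨c, hx h.1⟩, h, rfl⟩⟩

open Classical in
-- Points in different shells have no common ancestor, so their factor is 1 and the two energies
-- merge into one sum.
lemma energy_eq_treeEnergy (g : (Fin d → ℤ) → (Fin d → ℤ) → ℝ≥0∞) (p : ℝ) (a : Fin d → ℤ)
    {C : Finset (Σ k : ℕ, CubeIn d k)} {G : Finset (Fin d → ℤ)}
    (hG : ∀ x ∈ G, ancestors x ⊆ C) {μ : Measure (Fin d → ℤ)} (hμ : μ (G : Set (Fin d → ℤ))ᶜ = 0) :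
    energyOff g a μ + energyOn g p a μ =
      treeEnergy (ancestorsIn C) G g (ENNReal.ofReal p) a fun x => μ {x} := by
  have h0 : ∀ x ∉ G, μ {x} = 0 := fun x hx => measure_mono_null (by simpa using hx) hμ
  unfold energyOff energyOn treeEnergy
  simp_rw [← ENNReal.tsum_add]
  rw [tsum_eq_sum (s := G)]
  · refine Finset.sum_congr rfl fun x hx => ?_
    rw [tsum_eq_sum (s := G)]
    · refine Finset.sum_congr rfl fun y _ => ?_
      rw [card_ancestorsIn_inter (hG x hx)]
      split_ifs with h
      · rw [zero_add, card_ancestors_inter h]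
      · rw [Finset.disjoint_iff_inter_eq_empty.1 (disjoint_ancestors h)]
        simp
    · intro y hy
      simp [h0 y hy]
  · intro x hx
    simp [h0 x hx]

lemma green_self_ne_zero (hX : IsMarkovChain P X) (y : Fin d → ℤ) : green P X y y ≠ 0 := by
  intro h
  have h1 := ENNReal.tsum_eq_zero.1 h 0
  rw [hX.start] at h1
  exact one_ne_zero h1

variable (β : Measure Bool) [IsProbabilityMeasure β]
  {C : Finset (Σ k : ℕ, CubeIn d k)} {G : Finset (Fin d → ℤ)}

open Classical in
lemma capacity_le (hX : IsMarkovChain P X) (hT : IsTransient P X) (a : Fin d → ℤ) {p : ℝ}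
    (hp : 0 < p) (hβ : β {true} = ENNReal.ofReal p) (hG : ∀ x ∈ G, ancestors x ⊆ C) :
    capacity (green P X) p (G : Set (Fin d → ℤ)) a ≤
      2 * ∫⁻ s, hitProb P X a (survivors (ancestorsIn C) G s) ∂Measure.pi (fun _ => β) := by
  have hp0 : ENNReal.ofReal p ≠ 0 := by simpa using hp
  refine iSup₂_le fun F₀ hF₀ => ?_
  rw [ENNReal.inv_le_iff_inv_le]
  refine le_iInf₂ fun μ hμ => ?_
  obtain ⟨hμ1, hμ2⟩ := hμ
  have hμG : μ (G : Set (Fin d → ℤ))ᶜ = 0 :=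
    measure_mono_null (Set.compl_subset_compl.2 hF₀.1) hμ2
  rw [energy_eq_treeEnergy _ p a hG hμG]
  by_cases h : ∀ y ∈ G, green P X a y = 0 → μ {y} = 0
  · have hsum : ∑ y ∈ G, μ {y} = 1 := by
      rw [sum_measure_singleton]
      exact (prob_compl_eq_zero_iff G.measurableSet).1 hμG
    have hmain := inv_two_mul_treeEnergy_le β (ancestorsIn C) G hX hT a (hβ ▸ hp0)
      (fun y => μ {y}) h hsum
    rw [hβ, ENNReal.inv_le_iff_inv_le] at hmain
    rw [ENNReal.mul_inv (Or.inl (by norm_num)) (Or.inl (by norm_num))]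
    calc _ ≤ 2⁻¹ * (2 * _) := mul_le_mul_right hmain _
      _ = _ := by
        rw [← mul_assoc, ENNReal.inv_mul_cancel (by norm_num) (by norm_num), one_mul]
  -- If μ charges a point y with g(a,y) = 0, the diagonal term at y is infinite because g(y,y) ≠ 0.
  · push Not at h
    obtain ⟨y, hy, hg, hμy⟩ := h
    have htop : treeEnergy (ancestorsIn C) G (green P X) (ENNReal.ofReal p) a
        (fun x => μ {x}) = ∞ := by
      refine ENNReal.sum_eq_top.2 ⟨y, hy, ENNReal.sum_eq_top.2 ⟨y, hy, ?_⟩⟩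
      rw [hg, ENNReal.div_zero (green_self_ne_zero hX y), ENNReal.top_mul, ENNReal.top_mul hμy,
        ENNReal.top_mul hμy]
      exact pow_ne_zero _ (ENNReal.inv_ne_zero.2 ENNReal.ofReal_ne_top)
    rw [htop]
    exact le_top

open Classical in
lemma le_capacity (hX : IsMarkovChain P X) (hT : IsTransient P X) (a : Fin d → ℤ) {p : ℝ}
    (hp : 0 < p) (hβ : β {true} = ENNReal.ofReal p) (hG : ∀ x ∈ G, ancestors x ⊆ C) :
    ∫⁻ s, hitProb P X a (survivors (ancestorsIn C) G s) ∂Measure.pi (fun _ => β) ≤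
      32 * capacity (green P X) p (G : Set (Fin d → ℤ)) a := by
  have := hX.isProb a
  have hp0 : ENNReal.ofReal p ≠ 0 := by simpa using hp
  have hJ := treeEnergy_hitDist_le β (ancestorsIn C) G treeKey hX hT (fun w x y hwx hxy c hc => by
    rw [Finset.mem_inter, mem_ancestorsIn, mem_ancestorsIn] at hc
    exact mem_ancestorsIn.2 (ancestors_inter_subset hwx hxy (Finset.mem_inter.2 hc)))
    a (hβ ▸ hp0)
  rw [← sum_hitDist β (ancestorsIn C) G hX a]
  set ν := hitDist β (ancestorsIn C) G P X a with hν
  set M := ∑ x ∈ G, ν x with hM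
  have hM1 : M ≤ 1 := by
    rw [hM, sum_hitDist β (ancestorsIn C) G hX a]
    calc _ ≤ ∫⁻ _, 1 ∂Measure.pi (fun _ => β) := lintegral_mono fun s => prob_le_one
      _ = 1 := by simp
  have hMtop : M ≠ ∞ := ne_top_of_le_ne_top ENNReal.one_ne_top hM1
  rcases eq_or_ne M 0 with hM0 | hM0
  · rw [hM0]
    exact zero_le
  -- The test measure is the normalised hitting distribution. Energy is quadratic, so the bound 32 M
  -- becomes 32/M.
  set μ : Measure (Fin d → ℤ) := ∑ x ∈ G, (M⁻¹ * ν x) • Measure.dirac x with hμ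
  have hμs : ∀ x ∈ G, μ {x} = M⁻¹ * ν x := by
    intro x hx
    rw [hμ, Measure.finsetSum_apply, Finset.sum_eq_single_of_mem x hx]
    · simp
    · intro y _ hy
      simp [hy]
  have hμG : μ (G : Set (Fin d → ℤ))ᶜ = 0 := by
    rw [hμ, Measure.finsetSum_apply]
    refine Finset.sum_eq_zero fun x hx => ?_
    simp [hx]
  have hμ1 : IsProbabilityMeasure μ := by
    refine ⟨?_⟩
    rw [hμ, Measure.finsetSum_apply]
    simp only [Measure.smul_apply, measure_univ, smul_eq_mul, mul_one]
    rw [← Finset.mul_sum, ENNReal.inv_mul_cancel hM0 hMtop]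
  have hE : energyOff (green P X) a μ + energyOn (green P X) p a μ ≤ 32 * M⁻¹ := by
    rw [energy_eq_treeEnergy _ p a hG hμG]
    calc treeEnergy (ancestorsIn C) G (green P X) (ENNReal.ofReal p) a (fun x => μ {x})
        = M⁻¹ * M⁻¹ * treeEnergy (ancestorsIn C) G (green P X) (ENNReal.ofReal p) a ν := by
          unfold treeEnergy
          rw [Finset.mul_sum]
          refine Finset.sum_congr rfl fun x hx => ?_
          rw [Finset.mul_sum]
          refine Finset.sum_congr rfl fun y hy => ?_
          dsimp only
          rw [hμs x hx, hμs y hy]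
          ring
      _ ≤ M⁻¹ * M⁻¹ * (32 * M) := by
          rw [hβ] at hJ
          exact mul_le_mul_right hJ _
      _ = 32 * M⁻¹ * (M⁻¹ * M) := by ring
      _ = 32 * M⁻¹ := by rw [ENNReal.inv_mul_cancel hM0 hMtop, mul_one]
  have hcap : (32 * M⁻¹)⁻¹ ≤ capacity (green P X) p (G : Set (Fin d → ℤ)) a := by
    refine le_trans ?_ (le_iSup₂_of_le (G : Set (Fin d → ℤ)) ⟨subset_rfl, G.finite_toSet⟩ le_rfl)
    exact ENNReal.inv_le_inv.2 ((iInf₂_le μ ⟨hμ1, hμG⟩).trans hE)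
  rw [ENNReal.mul_inv (Or.inl (by norm_num)) (Or.inl (by norm_num)), inv_inv] at hcap
  calc M = 32 * (32⁻¹ * M) := by
        rw [← mul_assoc, ENNReal.mul_inv_cancel (by norm_num) (by norm_num), one_mul]
    _ ≤ _ := mul_le_mul_right hcap 32

end Capacity

/-! ### Intersection of independent percolations -/

section Intersection

/-- The law of the indicator of `{U < q}` (up to null events) for a uniform variable `U`. -/
noncomputable def keepLaw (q : ℝ) : Measure Bool :=
  (volume.restrict (Set.Icc (0 : ℝ) 1)).map fun u => decide (u ∈ Set.Ioo 0 q)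

lemma measurable_decide_mem_Ioo (q : ℝ) : Measurable fun u : ℝ => decide (u ∈ Set.Ioo 0 q) :=
  measurable_to_bool (by
    have : (fun u : ℝ => decide (u ∈ Set.Ioo 0 q)) ⁻¹' {true} = Set.Ioo 0 q := by
      ext u
      simp
    rw [this]
    exact measurableSet_Ioo)

instance (q : ℝ) : IsProbabilityMeasure (keepLaw q) := by
  have : IsProbabilityMeasure (volume.restrict (Set.Icc (0 : ℝ) 1)) := ⟨by simp⟩
  exact Measure.isProbabilityMeasure_map (measurable_decide_mem_Ioo q).aemeasurable

lemma keepLaw_true {q : ℝ} (hq : q ≤ 1) : keepLaw q {true} = ENNReal.ofReal q := by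
  rw [keepLaw, Measure.map_apply (measurable_decide_mem_Ioo q) (measurableSet_singleton _)]
  have : (fun u : ℝ => decide (u ∈ Set.Ioo 0 q)) ⁻¹' {true} = Set.Ioo 0 q := by
    ext u
    simp
  rw [this, Measure.restrict_apply measurableSet_Ioo, Set.inter_eq_left.2, Real.volume_Ioo,
    sub_zero]
  exact fun u hu => ⟨hu.1.le, hu.2.le.trans hq⟩

/-- The law of the conjunction of two independent indicators. -/
noncomputable def andLaw (β β' : Measure Bool) : Measure Bool :=
  (β.prod β').map fun b => b.1 && b.2

instance (β β' : Measure Bool) [IsProbabilityMeasure β] [IsProbabilityMeasure β'] :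
    IsProbabilityMeasure (andLaw β β') :=
  Measure.isProbabilityMeasure_map Measurable.of_discrete.aemeasurable

lemma andLaw_true (β β' : Measure Bool) [IsProbabilityMeasure β] [IsProbabilityMeasure β'] :
    andLaw β β' {true} = β {true} * β' {true} := by
  rw [andLaw, Measure.map_apply .of_discrete .of_discrete, ← Measure.prod_prod]
  congr 1
  ext ⟨b, b'⟩
  simp

/-- Couple the percolations coordinatewise, regroup the pairs into two independent configurations,
and use Tonelli. The outer variable t plays the role of the given percolation. -/
lemma lintegral_andLaw {κ : Type*} [Fintype κ] (β β' : Measure Bool) [IsProbabilityMeasure β]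
    [IsProbabilityMeasure β'] (f : (κ → Bool) → ℝ≥0∞) :
    ∫⁻ u, f u ∂Measure.pi (fun _ => andLaw β β') =
      ∫⁻ t, ∫⁻ s, f (fun c => s c && t c) ∂Measure.pi (fun _ => β)
        ∂Measure.pi (fun _ => β') := by
  have h1 : MeasurePreserving (fun (b : κ → Bool × Bool) c => (b c).1 && (b c).2)
      (Measure.pi fun _ => β.prod β') (Measure.pi fun _ => andLaw β β') :=
    measurePreserving_pi (fun _ => β.prod β') (fun _ => andLaw β β')
      (f := fun _ b => b.1 && b.2) fun _ => ⟨Measurable.of_discrete, rfl⟩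
  have h2 := (measurePreserving_arrowProdEquivProdArrow Bool Bool κ
    (fun _ => β) (fun _ => β')).symm
  rw [← h1.lintegral_comp .of_discrete, ← h2.lintegral_comp .of_discrete,
    lintegral_prod_symm _ Measurable.of_discrete.aemeasurable]
  rfl

lemma survivors_survivors {d : ℕ} {κ : Type*} (anc : (Fin d → ℤ) → Finset κ)
    (F : Finset (Fin d → ℤ)) (s t : κ → Bool) :
    survivors anc (survivors anc F t) s = survivors anc F fun c => s c && t c := by
  ext x
  simp only [mem_survivors, Bool.and_eq_true]
  exact ⟨fun h => ⟨h.1.1, fun c hc => ⟨h.2 c hc, h.1.2 c hc⟩⟩,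
    fun h => ⟨⟨h.1, fun c hc => (h.2 c hc).2⟩, fun c hc => (h.2 c hc).1⟩⟩

/-- The joint law of the events that the cubes in a finite set are kept. -/
lemma map_keep_eq_pi {d : ℕ} {Ω : Type*} [MeasurableSpace Ω] {Pr : Measure Ω}
    {U : (k : ℕ) → CubeIn d k → Ω → ℝ} (hU : IsUniformWeights Pr U) (q : ℝ)
    (C : Finset (Σ k : ℕ, CubeIn d k)) :
    Pr.map (fun ω (c : C) => decide (U c.1.1 c.1.2 ω ∈ Set.Ioo 0 q)) =
      Measure.pi fun _ => keepLaw q := by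
  have hind : iIndepFun (fun (c : C) ω => decide (U c.1.1 c.1.2 ω ∈ Set.Ioo 0 q)) Pr :=
    (hU.indep.precomp Subtype.val_injective).comp (fun _ u => decide (u ∈ Set.Ioo 0 q))
      fun _ => measurable_decide_mem_Ioo q
  have hm : ∀ c : C, Measurable fun ω => decide (U c.1.1 c.1.2 ω ∈ Set.Ioo 0 q) :=
    fun c => (measurable_decide_mem_Ioo q).comp (hU.measurable _ _)
  rw [hind.map_fun_eq_pi_map fun c => (hm c).aemeasurable]
  congr 1
  funext c
  rw [keepLaw, ← hU.uniform c.1.1 c.1.2,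
    Measure.map_map (measurable_decide_mem_Ioo q) (hU.measurable _ _)]
  rfl

end Intersection

end MacroPercolation

/-! ### The comparison of capacities -/

theorem mainTheorem8 {d : ℕ} (hd : 1 ≤ d)
    {A : Type*} [MeasurableSpace A]
    (P : (Fin d → ℤ) → Measure A) (X : ℕ → A → (Fin d → ℤ))
    (hX : MacroPercolation.IsMarkovChain P X) (hT : MacroPercolation.IsTransient P X)
    {Ω : Type*} [MeasurableSpace Ω] (Pr : Measure Ω) [IsProbabilityMeasure Pr]
    (U : (k : ℕ) → MacroPercolation.CubeIn d k → Ω → ℝ)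
    (hU : MacroPercolation.IsUniformWeights Pr U)
    (a : Fin d → ℤ) (F : Set (Fin d → ℤ)) (hF : F.Finite)
    (p q : ℝ) (hp : p ∈ Set.Icc ((2 : ℝ) ^ (-(d : ℤ))) 1)
    (hq : q ∈ Set.Icc ((2 : ℝ) ^ (-(d : ℤ))) 1) :
    (256 : ℝ≥0∞)⁻¹ * MacroPercolation.capacity (MacroPercolation.green P X) (p * q) F a ≤
        ∫⁻ ω, MacroPercolation.capacity (MacroPercolation.green P X) p
          ({x | MacroPercolation.toPoint x ∈
            MacroPercolation.percolation q (fun k Q => U k Q ω)} ∩ F) a ∂Pr ∧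
      ∫⁻ ω, MacroPercolation.capacity (MacroPercolation.green P X) p
          ({x | MacroPercolation.toPoint x ∈
            MacroPercolation.percolation q (fun k Q => U k Q ω)} ∩ F) a ∂Pr ≤
        256 * MacroPercolation.capacity (MacroPercolation.green P X) (p * q) F a := by
  classical
  obtain ⟨F, rfl⟩ := hF.exists_finset_coe
  -- Only the ancestors of the points of F matter, which reduces the percolation to finitely many
  -- independent coordinates.
  set C : Finset (Σ k : ℕ, MacroPercolation.CubeIn d k) :=
    F.biUnion MacroPercolation.ancestors with hC
  set anc := MacroPercolation.ancestorsIn C with hanc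
  set g := MacroPercolation.green P X with hg
  have hF : ∀ x ∈ F, MacroPercolation.ancestors x ⊆ C :=
    fun x hx => Finset.subset_biUnion_of_mem _ hx
  have hp0 : 0 < p := lt_of_lt_of_le (by positivity) hp.1
  have hq0 : 0 < q := lt_of_lt_of_le (by positivity) hq.1
  have hpβ := MacroPercolation.keepLaw_true hp.2
  have hpq : MacroPercolation.andLaw (MacroPercolation.keepLaw p) (MacroPercolation.keepLaw q)
      {true} = ENNReal.ofReal (p * q) := by
    rw [MacroPercolation.andLaw_true, hpβ, MacroPercolation.keepLaw_true hq.2,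
      ENNReal.ofReal_mul hp0.le]
  have hset : ∀ ω, {x | MacroPercolation.toPoint x ∈
      MacroPercolation.percolation q (fun k Q => U k Q ω)} ∩ (F : Set (Fin d → ℤ)) =
      MacroPercolation.survivors anc F
        fun c : C => decide (U c.1.1 c.1.2 ω ∈ Set.Ioo 0 q) := by
    intro ω
    ext x
    simp only [Set.mem_inter_iff, Set.mem_ofPred_eq, Finset.mem_coe,
      MacroPercolation.mem_survivors, MacroPercolation.toPoint_mem_percolation hd, hanc,
      MacroPercolation.mem_ancestorsIn, decide_eq_true_eq]
    exact ⟨fun h => ⟨h.2, fun c hc => h.1 c.1 hc⟩,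
      fun h => ⟨fun c hc => h.2 ⟨c, hF x h.1 hc⟩ hc, h.1⟩⟩
  have hlaw : ∫⁻ ω, MacroPercolation.capacity g p ({x | MacroPercolation.toPoint x ∈
      MacroPercolation.percolation q (fun k Q => U k Q ω)} ∩ (F : Set (Fin d → ℤ))) a ∂Pr =
      ∫⁻ t, MacroPercolation.capacity g p
        (MacroPercolation.survivors anc F t : Set (Fin d → ℤ)) a
        ∂Measure.pi (fun _ : C => MacroPercolation.keepLaw q) := by
    simp_rw [hset]
    rw [← MacroPercolation.map_keep_eq_pi hU q C, lintegral_map .of_discrete]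
    exact measurable_pi_lambda _ fun c =>
      (MacroPercolation.measurable_decide_mem_Ioo q).comp (hU.measurable _ _)
  have hsub : ∀ t : C → Bool, ∀ x ∈ MacroPercolation.survivors anc F t,
      MacroPercolation.ancestors x ⊆ C :=
    fun t x hx => hF x (MacroPercolation.survivors_subset anc F t hx)
  have hint := MacroPercolation.lintegral_andLaw (κ := C) (MacroPercolation.keepLaw p)
    (MacroPercolation.keepLaw q)
    fun s => MacroPercolation.hitProb P X a (MacroPercolation.survivors anc F s)
  -- A hit of the pq-percolation becomes a hit of a fresh p-percolation on the survivors of the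
  -- q-percolation, which are fixed by t.
  simp_rw [← MacroPercolation.survivors_survivors] at hint
  have hle := MacroPercolation.le_capacity _ hX hT a (mul_pos hp0 hq0) hpq hF
  have hge := MacroPercolation.capacity_le _ hX hT a (mul_pos hp0 hq0) hpq hF
  rw [hint] at hle hge
  rw [hlaw]
  set cap := MacroPercolation.capacity g (p * q) (F : Set (Fin d → ℤ)) a
  constructor
  -- The factor 2 comes from the pq-percolation on F, and 32 from the p-percolation for fixed t. In
  -- the upper bound the roles are exchanged.
  · have h1 : cap ≤ 256 * ∫⁻ t, MacroPercolation.capacity g p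
        (MacroPercolation.survivors anc F t : Set (Fin d → ℤ)) a
        ∂Measure.pi (fun _ : C => MacroPercolation.keepLaw q) := by
      calc cap ≤ 2 * _ := hge
        _ ≤ 2 * (32 * ∫⁻ t, MacroPercolation.capacity g p
            (MacroPercolation.survivors anc F t : Set (Fin d → ℤ)) a
            ∂Measure.pi (fun _ : C => MacroPercolation.keepLaw q)) := by
          refine mul_le_mul_right ?_ 2
          rw [← lintegral_const_mul _ .of_discrete]
          exact lintegral_mono fun t => MacroPercolation.le_capacity _ hX hT a hp0 hpβ (hsub t)
        _ ≤ _ := by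
          rw [← mul_assoc]
          exact mul_le_mul_left (by norm_num) _
    calc (256 : ℝ≥0∞)⁻¹ * cap ≤ 256⁻¹ * (256 * _) := mul_le_mul_right h1 _
      _ = _ := by
        rw [← mul_assoc, ENNReal.inv_mul_cancel (by norm_num) (by norm_num), one_mul]
  · calc _ ≤ 2 * _ := by
          rw [← lintegral_const_mul _ .of_discrete]
          exact lintegral_mono fun t => MacroPercolation.capacity_le _ hX hT a hp0 hpβ (hsub t)
      _ ≤ 2 * (32 * cap) := mul_le_mul_right hle 2
      _ ≤ 256 * cap := by
          rw [← mul_assoc]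
          exact mul_le_mul_left (by norm_num) _
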